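/- **Setting.** Polarized SILL is a session-typed language with a functional layer. Its denotational semantics works with *domains* (dcpos with a least element $\bot$) and Scott-continuous functions; $D_\bot$ is the lifting of $D$, $\mathrm{up}:D\to D_\bot$ its unit (write $[d]=\mathrm{up}(d)$), and $\mathrm{down}:D_\bot\to D$ maps $\bot\mapsto\bot$ and $[d]\mapsto d$. Session types $A$ have a polarity in $\{-,+\}$ and are built from type variables, recursive types $\rho\alpha.A$, and $\mathbf 1,\ {\downarrow}A,\ {\oplus}\{l:A_l\}_{l\in L},\ A\otimes B,\ \tau\wedge A$ (positive) and ${\uparrow}A,\ \&\{l:A_l\}_{l\in L},\ A\multimap B,\ \tau\supset A$ (negative), where $L$ is finite and $\tau$ is a functional type (a function type $\tau\to\sigma$ or a type of quoted processes). The downshift ${\downarrow}A$ is formed from a negative $A$. A closed session type $A$ denotes two domains, its negative aspect $[\![A]\!]^-$ and its positive aspect $[\![A]\!]^+$; in particular $[\![{\downarrow}A]\!]^-=[\![A]\!]^-$ and $[\![{\downarrow}A]\!]^+=[\![A]\!]^+_\bot$. A process judgment $\Psi;\Delta\vdash P::c:C$ says that $P$ offers the protocol $C$ on channel $c$ and uses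 the channels in the linear context $\Delta=a_1:A_1,\dots,a_n:A_n$, where $c,a_1,\dots,a_n$ are distinct and $\Psi$ is a context of functional variables. By induction on the typing derivation, over all the rules of the language, it denotes a continuous function $$[\![\Psi;\Delta\vdash P::c:C]\!]:[\![\Psi]\!]\to\bigl[[\![\Delta]\!]^+\times[\![C]\!]^-\to[\![\Delta]\!]^-\times[\![C]\!]^+\bigr],$$ where $[\![\Psi]\!]$ and $[\![\Delta]\!]^{\pm}$ are products indexed by the names in the context. Write $[\![P]\!]$ for this function. The clauses for the processes in the proposition are as follows, for $u\in[\![\Psi]\!]$. * Cut: for $\Psi;\Delta_1\vdash P::a:A$ and $\Psi;a:A,\Delta_2\vdash Q::c:C$ one has $\Psi;\Delta_1,\Delta_2\vdash (a\leftarrow P;Q)::c:C$, and $[\![a\leftarrow P;Q]\!]u=\mathrm{Tr}^{a^-\times a^+}\bigl([\![P]\!]u\times[\![Q]\!]u\bigr)$, the trace over $[\![A]\!]^-\times[\![A]\!]^+$. That is, it maps $(\delta_1^+,\delta_2^+,c^-)$ to $(\delta_1^-,\delta_2^-,c^+)$, where $\delta_1^-,\delta_2^-,a^-,a^+,c^+$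 are the least solution of $(\delta_1^-,a^+)=[\![P]\!]u(\delta_1^+,a^-)$ and $(a^-,\delta_2^-,c^+)=[\![Q]\!]u(a^+,\delta_2^+,c^-)$. * Sending a shift: if $\Psi;\Delta\vdash P::a:A$, then $\Psi;\Delta\vdash(\mathsf{send}\ a\ \mathsf{shift};P)::a:{\downarrow}A$ and $[\![\mathsf{send}\ a\ \mathsf{shift};P]\!]u=(\mathrm{id}\times(a^+:\mathrm{up}))\circ[\![P]\!]u$. * Receiving a shift: if $\Psi;\Delta,a:A\vdash Q::c:C$, then $\Psi;\Delta,a:{\downarrow}A\vdash(\mathsf{shift}\leftarrow\mathsf{recv}\ a;Q)::c:C$, and $[\![\mathsf{shift}\leftarrow\mathsf{recv}\ a;Q]\!]u$ maps every argument with $a^+=\bot$ to $\bot$ and agrees with $[\![Q]\!]u\circ(\mathrm{id}\times(a^+:\mathrm{down}))$ on all other arguments. Two processes $P,P'$ of the same judgment are *equivalent*, $P\equiv P'$, if $[\![P]\!]=[\![P']\!]$. **Proposition ($\eta$ for downshift).** Let $A$ be a closed negative session type, and let $\Psi;\Delta_1\vdash P::a:A$ and $\Psi;a:A,\Delta_2\vdash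 Q::c:C$, where the names in $\Delta_1$, $\Delta_2$, $a$, $c$ are pairwise distinct. Then $$a\leftarrow P;\,Q\ \equiv\ a\leftarrow(\mathsf{send}\ a\ \mathsf{shift};P);\,(\mathsf{shift}\leftarrow\mathsf{recv}\ a;Q).$$ -/

import Mathlib

/-! ## Pointed directed-complete partial orders and continuous functions -/

/-- Directed-complete partial orders: every nonempty directed subset has a least upper bound. -/
class IsDcpo (α : Type) [PartialOrder α] : Prop where
  exists_lub : ∀ s : Set α, s.Nonempty → DirectedOn (· ≤ ·) s → ∃ x, IsLUB s x

/-- A domain: a directed-complete partial order with a least element. -/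
structure Dom where
  carrier : Type
  [po : PartialOrder carrier]
  [bot : OrderBot carrier]
  [isDcpo : IsDcpo carrier]

instance : CoeSort Dom Type := ⟨Dom.carrier⟩
attribute [instance] Dom.po Dom.bot Dom.isDcpo

/-- Scott-continuous functions. -/
structure ContMap (α β : Type) [PartialOrder α] [PartialOrder β] where
  toFun : α → β
  cont : ScottContinuous toFun

section ContMap

variable {α β γ : Type} [PartialOrder α] [PartialOrder β] [PartialOrder γ]

instance : FunLike (ContMap α β) α β where
  coe := ContMap.toFun
  coe_injective f g h := by cases f; cases g; cases h; rfl

@[ext] theorem ContMap.ext {f g : ContMap α β} (h : ∀ x, f x = g x) : f = g :=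
  DFunLike.ext f g h

@[fun_prop] theorem ContMap.continuous (f : ContMap α β) : ScottContinuous (f : α → β) := f.cont

instance : PartialOrder (ContMap α β) := PartialOrder.lift _ DFunLike.coe_injective

instance [OrderBot β] : OrderBot (ContMap α β) where
  bot := ⟨fun _ => ⊥, ScottContinuous.const _⟩
  bot_le f x := (bot_le : ⊥ ≤ f x)

theorem ContMap.isLUB_of_apply {s : Set (ContMap α β)} {g : ContMap α β}
    (h : ∀ x, IsLUB ((fun f : ContMap α β => f x) '' s) (g x)) : IsLUB s g :=
  ⟨fun f hf x => (h x).1 ⟨f, hf, rfl⟩, fun k hk x => (h x).2 (by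
    rintro _ ⟨f, hf, rfl⟩; exact hk hf x)⟩

/-- Directed sets of continuous functions have pointwise least upper bounds. -/
theorem ContMap.exists_lub [IsDcpo β] (s : Set (ContMap α β)) (hs : s.Nonempty)
    (hd : DirectedOn (· ≤ ·) s) :
    ∃ g : ContMap α β, ∀ x, IsLUB ((fun f : ContMap α β => f x) '' s) (g x) := by
  have hx : ∀ x, ∃ y, IsLUB ((fun f : ContMap α β => f x) '' s) y := fun x =>
    IsDcpo.exists_lub _ (hs.image _) (by
      rintro _ ⟨f, hf, rfl⟩ _ ⟨g, hg, rfl⟩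
      obtain ⟨k, hk, h1, h2⟩ := hd f hf g hg
      exact ⟨_, ⟨k, hk, rfl⟩, h1 x, h2 x⟩)
  choose g hg using hx
  refine ⟨⟨g, ?_⟩, hg⟩
  intro d hne hdir a ha
  constructor
  · rintro _ ⟨x, hxd, rfl⟩
    refine (hg x).2 ?_
    rintro _ ⟨f, hf, rfl⟩
    exact (f.cont.monotone (ha.1 hxd)).trans ((hg a).1 ⟨f, hf, rfl⟩)
  · intro u hu
    refine (hg a).2 ?_
    rintro _ ⟨f, hf, rfl⟩
    refine (f.cont hne hdir ha).2 ?_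
    rintro _ ⟨x, hxd, rfl⟩
    exact ((hg x).1 ⟨f, hf, rfl⟩).trans (hu ⟨x, hxd, rfl⟩)

instance [IsDcpo β] : IsDcpo (ContMap α β) := ⟨fun s hs hd =>
  let ⟨g, hg⟩ := ContMap.exists_lub s hs hd
  ⟨g, ContMap.isLUB_of_apply hg⟩⟩

theorem ContMap.isLUB_apply [IsDcpo β] {s : Set (ContMap α β)} (hs : s.Nonempty)
    (hd : DirectedOn (· ≤ ·) s) {g : ContMap α β} (h : IsLUB s g) (x : α) :
    IsLUB ((fun f : ContMap α β => f x) '' s) (g x) := by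
  obtain ⟨k, hk⟩ := ContMap.exists_lub s hs hd
  rw [h.unique (ContMap.isLUB_of_apply hk)]
  exact hk x

/-- Strict continuous functions. -/
abbrev StrictMap (α β : Type) [PartialOrder α] [PartialOrder β] [OrderBot α] [OrderBot β] : Type :=
  {f : ContMap α β // f ⊥ = ⊥}

variable [OrderBot α] [OrderBot β] [OrderBot γ]

instance : OrderBot (StrictMap α β) where
  bot := ⟨⊥, rfl⟩
  bot_le f := (bot_le : ⊥ ≤ f.1)

theorem StrictMap.isLUB_of_apply {s : Set (StrictMap α β)} {g : StrictMap α β}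
    (h : ∀ x, IsLUB ((fun f : StrictMap α β => f.1 x) '' s) (g.1 x)) : IsLUB s g :=
  ⟨fun f hf x => (h x).1 ⟨f, hf, rfl⟩, fun k hk x => (h x).2 (by
    rintro _ ⟨f, hf, rfl⟩; exact hk hf x)⟩

theorem StrictMap.exists_lub [IsDcpo β] (s : Set (StrictMap α β)) (hs : s.Nonempty)
    (hd : DirectedOn (· ≤ ·) s) :
    ∃ g : StrictMap α β, ∀ x, IsLUB ((fun f : StrictMap α β => f.1 x) '' s) (g.1 x) := by
  obtain ⟨g, hg⟩ := ContMap.exists_lub (Subtype.val '' s) (hs.image _) (by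
    rintro _ ⟨f, hf, rfl⟩ _ ⟨g, hg, rfl⟩
    obtain ⟨k, hk, h1, h2⟩ := hd f hf g hg
    exact ⟨_, ⟨k, hk, rfl⟩, h1, h2⟩)
  simp only [Set.image_image] at hg
  refine ⟨⟨g, le_bot_iff.1 ((hg ⊥).2 ?_)⟩, hg⟩
  rintro _ ⟨f, hf, rfl⟩
  exact f.2.le

instance [IsDcpo β] : IsDcpo (StrictMap α β) := ⟨fun s hs hd =>
  let ⟨g, hg⟩ := StrictMap.exists_lub s hs hd
  ⟨g, StrictMap.isLUB_of_apply hg⟩⟩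

theorem StrictMap.isLUB_apply [IsDcpo β] {s : Set (StrictMap α β)} (hs : s.Nonempty)
    (hd : DirectedOn (· ≤ ·) s) {g : StrictMap α β} (h : IsLUB s g) (x : α) :
    IsLUB ((fun f : StrictMap α β => f.1 x) '' s) (g.1 x) := by
  obtain ⟨k, hk⟩ := StrictMap.exists_lub s hs hd
  rw [h.unique (StrictMap.isLUB_of_apply hk)]
  exact hk x

theorem StrictMap.ext {f g : StrictMap α β} (h : ∀ x, f.1 x = g.1 x) : f = g :=
  Subtype.ext (ContMap.ext h)

end ContMap

section Constructions

variable {α β ι : Type}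

instance : IsDcpo PUnit := ⟨fun _ _ _ => ⟨⟨⟩, fun _ _ => le_rfl, fun _ _ => le_rfl⟩⟩

instance [PartialOrder α] [PartialOrder β] [IsDcpo α] [IsDcpo β] : IsDcpo (α × β) :=
  ⟨fun s hs hd => by
    obtain ⟨x, hx⟩ := IsDcpo.exists_lub (Prod.fst '' s) (hs.image _) hd.fst
    obtain ⟨y, hy⟩ := IsDcpo.exists_lub (Prod.snd '' s) (hs.image _) hd.snd
    exact ⟨(x, y), isLUB_prod.2 ⟨hx, hy⟩⟩⟩

instance {α : ι → Type} [∀ i, PartialOrder (α i)] [∀ i, IsDcpo (α i)] : IsDcpo (∀ i, α i) :=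
  ⟨fun s hs hd => by
    have h : ∀ i, ∃ x, IsLUB (Function.eval i '' s) x := fun i =>
      IsDcpo.exists_lub _ (hs.image _) (by
        rintro _ ⟨f, hf, rfl⟩ _ ⟨g, hg, rfl⟩
        obtain ⟨k, hk, h1, h2⟩ := hd f hf g hg
        exact ⟨_, ⟨k, hk, rfl⟩, h1 i, h2 i⟩)
    choose x hx using h
    exact ⟨x, isLUB_pi.2 hx⟩⟩

theorem isLUB_withBot [PartialOrder α] {t : Set α} {x : α} {s : Set (WithBot α)}
    (ht : t.Nonempty) (hts : ∀ a, a ∈ t ↔ (a : WithBot α) ∈ s) :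
    IsLUB s (x : WithBot α) ↔ IsLUB t x := by
  constructor
  · intro h
    refine ⟨fun a ha => WithBot.coe_le_coe.1 (h.1 ((hts a).1 ha)), fun u hu => ?_⟩
    refine WithBot.coe_le_coe.1 (h.2 ?_)
    intro b hb
    induction b with
    | bot => exact bot_le
    | coe b => exact WithBot.coe_le_coe.2 (hu ((hts b).2 hb))
  · intro h
    constructor
    · intro b hb
      induction b with
      | bot => exact bot_le
      | coe b => exact WithBot.coe_le_coe.2 (h.1 ((hts b).2 hb))
    · intro u hu
      induction u with
      | bot =>
        obtain ⟨a, ha⟩ := ht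
        exact absurd (hu ((hts a).1 ha)) (by simp)
      | coe u =>
        exact WithBot.coe_le_coe.2 (h.2 fun a ha => WithBot.coe_le_coe.1 (hu ((hts a).1 ha)))

theorem directedOn_withBot [PartialOrder α] {t : Set α} {s : Set (WithBot α)}
    (hd : DirectedOn (· ≤ ·) s) (hts : ∀ a, a ∈ t ↔ (a : WithBot α) ∈ s) :
    DirectedOn (· ≤ ·) t := by
  intro a ha b hb
  obtain ⟨c, hc, h1, h2⟩ := hd _ ((hts a).1 ha) _ ((hts b).1 hb)
  induction c with
  | bot => simp at h1
  | coe c => exact ⟨c, (hts c).2 hc, WithBot.coe_le_coe.1 h1, WithBot.coe_le_coe.1 h2⟩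

instance [PartialOrder α] [IsDcpo α] : IsDcpo (WithBot α) :=
  ⟨fun s hs hd => by
    by_cases ht : {a : α | (a : WithBot α) ∈ s}.Nonempty
    · obtain ⟨x, hx⟩ := IsDcpo.exists_lub _ ht (directedOn_withBot hd fun _ => Iff.rfl)
      exact ⟨x, (isLUB_withBot ht fun _ => Iff.rfl).2 hx⟩
    · refine ⟨⊥, fun b hb => ?_, fun u _ => bot_le⟩
      induction b with
      | bot => exact bot_le
      | coe b => exact absurd ⟨b, hb⟩ ht⟩

theorem sigma_directed {α : ι → Type} [∀ i, PartialOrder (α i)] {s : Set (Σ i, α i)}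
    (hs : s.Nonempty) (hd : DirectedOn (· ≤ ·) s) :
    ∃ i, ∃ t : Set (α i), t.Nonempty ∧ DirectedOn (· ≤ ·) t ∧ s = Sigma.mk i '' t := by
  obtain ⟨⟨i, a⟩, ha⟩ := hs
  have key : s = Sigma.mk i '' {x | (⟨i, x⟩ : Σ i, α i) ∈ s} := by
    ext ⟨j, b⟩
    constructor
    · intro hb
      obtain ⟨⟨k, c⟩, hc, h1, h2⟩ := hd _ ha _ hb
      obtain ⟨⟩ := h1
      obtain ⟨⟩ := h2
      exact ⟨b, hb, rfl⟩
    · rintro ⟨x, hx, h⟩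
      exact h ▸ hx
  refine ⟨i, _, ⟨a, ha⟩, ?_, key⟩
  intro x hx y hy
  obtain ⟨⟨k, c⟩, hc, h1, h2⟩ := hd _ hx _ hy
  cases h1 with | fiber _ _ z h1 =>
  exact ⟨z, hc, h1, Sigma.mk_le_mk_iff.1 h2⟩

theorem sigma_isLUB {α : ι → Type} [∀ i, PartialOrder (α i)] {i : ι} {t : Set (α i)}
    (ht : t.Nonempty) {x : α i} :
    IsLUB (Sigma.mk i '' t) (⟨i, x⟩ : Σ i, α i) ↔ IsLUB t x := by
  constructor
  · intro h
    refine ⟨fun a ha => Sigma.mk_le_mk_iff.1 (h.1 ⟨a, ha, rfl⟩), fun u hu => ?_⟩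
    refine Sigma.mk_le_mk_iff.1 (h.2 (?_ : (⟨i, u⟩ : Σ i, α i) ∈ _))
    rintro _ ⟨a, ha, rfl⟩
    exact Sigma.mk_le_mk_iff.2 (hu ha)
  · intro h
    refine ⟨?_, ?_⟩
    · rintro _ ⟨a, ha, rfl⟩
      exact Sigma.mk_le_mk_iff.2 (h.1 ha)
    · rintro ⟨j, u⟩ hu
      obtain ⟨a, ha⟩ := ht
      obtain ⟨⟩ := hu ⟨a, ha, rfl⟩
      exact Sigma.mk_le_mk_iff.2 (h.2 fun b hb => Sigma.mk_le_mk_iff.1 (hu ⟨b, hb, rfl⟩))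

instance {α : ι → Type} [∀ i, PartialOrder (α i)] [∀ i, IsDcpo (α i)] : IsDcpo (Σ i, α i) :=
  ⟨fun s hs hd => by
    obtain ⟨i, t, ht, htd, rfl⟩ := sigma_directed hs hd
    obtain ⟨x, hx⟩ := IsDcpo.exists_lub t ht htd
    exact ⟨⟨i, x⟩, (sigma_isLUB ht).2 hx⟩⟩

end Constructions

namespace Dom

/-- The one-point domain. -/
abbrev unit : Dom := ⟨PUnit⟩

/-- Binary products. -/
abbrev prod (D E : Dom) : Dom := ⟨D × E⟩

/-- Products of arbitrary families. -/
abbrev pi {ι : Type} (D : ι → Dom) : Dom := ⟨∀ i, D i⟩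

/-- The function space `[D → E]`. -/
abbrev fn (D E : Dom) : Dom := ⟨ContMap D E⟩

/-- The strict function space. -/
abbrev sfn (D E : Dom) : Dom := ⟨StrictMap D E⟩

/-- The lifting `D_⊥`. -/
abbrev lift (D : Dom) : Dom := ⟨WithBot D⟩

/-- The coalesced sum of the lifted domains `(D i)_⊥`, presented as the lifted disjoint union of
the `D i`: its elements are `⊥` and the tagged elements `(i, x)` with `x : D i`. -/
abbrev csum {ι : Type} (D : ι → Dom) : Dom := ⟨WithBot (Σ i, D i)⟩

end Dom

/-! ## Combinators for continuous functions -/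

namespace ScottContinuous

variable {α β γ ι : Type} [PartialOrder α] [PartialOrder β] [PartialOrder γ]

@[fun_prop] theorem of_pi {δ : ι → Type} [∀ i, PartialOrder (δ i)] {f : α → ∀ i, δ i}
    (h : ∀ i, ScottContinuous fun x => f x i) : ScottContinuous f := by
  intro d hne hd a ha
  refine isLUB_pi.2 fun i => ?_
  rw [Set.image_image]
  exact h i hne hd ha

@[fun_prop] theorem eval {δ : ι → Type} [∀ i, PartialOrder (δ i)] (i : ι) :
    ScottContinuous fun x : ∀ i, δ i => x i := fun _ _ _ _ ha => isLUB_pi.1 ha i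

@[fun_prop] theorem contMap_apply [IsDcpo γ] {f : α → ContMap β γ} {g : α → β}
    (hf : ScottContinuous f) (hg : ScottContinuous g) : ScottContinuous fun x => f x (g x) := by
  have h : ScottContinuous fun p : ContMap β γ × β => p.1 p.2 :=
    ScottContinuous.fromProd (fun f => f.cont)
      (fun x _ hne hd _ ha => ContMap.isLUB_apply hne hd ha x)
  exact (hf.prodMk hg).comp h

@[fun_prop] theorem strictMap_val [IsDcpo β] [OrderBot α] [OrderBot β] :
    ScottContinuous fun f : StrictMap α β => f.1 := fun s hs hd g hg =>
  ContMap.isLUB_of_apply fun x => by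
    rw [Set.image_image]; exact StrictMap.isLUB_apply hs hd hg x

theorem contMap_mk {f : α → β → γ} (h : ScottContinuous fun p : α × β => f p.1 p.2) :
    ScottContinuous fun x =>
      (⟨f x, ((ScottContinuous.const x).prodMk .id).comp h⟩ : ContMap β γ) :=
  fun _ hne hd _ ha => ContMap.isLUB_of_apply fun y => by
    rw [Set.image_image]
    exact ((ScottContinuous.id.prodMk (ScottContinuous.const y)).comp h) hne hd ha

theorem withBot [OrderBot β] {f : WithBot α → β}
    (h0 : f ⊥ = ⊥) (h : ScottContinuous fun a : α => f a) : ScottContinuous f := by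
  have hm : Monotone f := by
    intro a b hab
    induction a with
    | bot => rw [h0]; exact bot_le
    | coe a =>
      induction b with
      | bot => simp at hab
      | coe b => exact h.monotone (WithBot.coe_le_coe.1 hab)
  intro s hs hd a ha
  refine ⟨by rintro _ ⟨x, hx, rfl⟩; exact hm (ha.1 hx), fun u hu => ?_⟩
  by_cases ht : {a : α | (a : WithBot α) ∈ s}.Nonempty
  · induction a with
    | bot =>
      obtain ⟨b, hb⟩ := ht
      simpa using ha.1 hb
    | coe a =>
      refine (h ht (directedOn_withBot hd fun _ => Iff.rfl)
        ((isLUB_withBot ht fun _ => Iff.rfl).1 ha)).2 ?_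
      rintro _ ⟨x, hx, rfl⟩
      exact hu ⟨_, hx, rfl⟩
  · have : a ≤ ⊥ := ha.2 fun b hb => by
      induction b with
      | bot => exact bot_le
      | coe b => exact absurd ⟨b, hb⟩ ht
    rw [le_bot_iff.1 this, h0]
    exact bot_le

@[fun_prop] theorem withBot_coe : ScottContinuous fun a : α => (a : WithBot α) := by
  intro s hs hd a ha
  exact (isLUB_withBot hs (by simp)).2 ha

theorem sigma {δ : ι → Type} [∀ i, PartialOrder (δ i)] {f : (Σ i, δ i) → β}
    (h : ∀ i, ScottContinuous fun x : δ i => f ⟨i, x⟩) : ScottContinuous f := by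
  rintro s hs hd ⟨j, a⟩ ha
  obtain ⟨i, t, ht, htd, rfl⟩ := sigma_directed hs hd
  obtain ⟨b, hb⟩ := ht
  cases ha.1 ⟨b, hb, rfl⟩ with | fiber _ _ _ _ =>
  rw [Set.image_image]
  exact h _ ⟨b, hb⟩ htd ((sigma_isLUB ⟨b, hb⟩).1 ha)

theorem sigma_mk {δ : ι → Type} [∀ i, PartialOrder (δ i)] (i : ι) :
    ScottContinuous fun x : δ i => (⟨i, x⟩ : Σ i, δ i) :=
  fun _ hs _ _ ha => (sigma_isLUB hs).2 ha

theorem strict [OrderBot β] [OrderBot γ] {j : α → β} {f : α → γ} (hj : ScottContinuous j)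
    (hf : ScottContinuous f) [DecidablePred fun x => j x = ⊥] :
    ScottContinuous fun x => if j x = ⊥ then ⊥ else f x := by
  have hm : ∀ x, (if j x = ⊥ then ⊥ else f x) ≤ f x := fun x => by split <;> simp
  intro s hs hd a ha
  by_cases h0 : j a = ⊥
  · simp only [h0, if_true]
    refine ⟨?_, fun _ _ => bot_le⟩
    rintro _ ⟨x, hx, rfl⟩
    have : j x = ⊥ := le_bot_iff.1 ((hj.monotone (ha.1 hx)).trans h0.le)
    simp [this]
  · simp only [h0, if_false]
    refine ⟨?_, fun u hu => ?_⟩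
    · rintro _ ⟨x, hx, rfl⟩
      exact (hm x).trans (hf.monotone (ha.1 hx))
    · have : ∃ x ∈ s, j x ≠ ⊥ := by
        by_contra hcon
        push Not at hcon
        refine h0 (le_bot_iff.1 ((hj hs hd ha).2 ?_))
        rintro _ ⟨x, hx, rfl⟩
        exact (hcon x hx).le
      obtain ⟨x0, hx0, hj0⟩ := this
      refine (hf hs hd ha).2 ?_
      rintro _ ⟨x, hx, rfl⟩
      obtain ⟨z, hz, h1, h2⟩ := hd x hx x0 hx0
      have hjz : j z ≠ ⊥ := fun h => hj0 (le_bot_iff.1 ((hj.monotone h2).trans h.le))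
      refine (hf.monotone h1).trans ?_
      have := hu ⟨z, hz, rfl⟩
      simpa [hjz] using this

end ScottContinuous

open Classical in
/-- `strictFn j f` is `f` made strict in the component of its argument picked out by `j`. -/
noncomputable def strictFn {D E F : Dom} (j : ContMap D E) (f : ContMap D F) : ContMap D F :=
  ⟨fun x => if j x = ⊥ then ⊥ else f x, j.cont.strict f.cont⟩

namespace ContMap

variable {D E F : Dom}

/-- The identity. -/
def id (D : Dom) : ContMap D D := ⟨fun x => x, by fun_prop⟩

/-- Composition, in the order `g ∘ f`. -/
def comp (g : ContMap E F) (f : ContMap D E) : ContMap D F := ⟨fun x => g (f x), by fun_prop⟩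

/-- Currying. -/
def curry (f : ContMap (D.prod E) F) : ContMap D (E.fn F) :=
  ⟨fun x => ⟨fun y => f (x, y), by fun_prop⟩, ScottContinuous.contMap_mk (by fun_prop)⟩

end ContMap

/-- The unit `up : D → D_⊥` of lifting. -/
def up (D : Dom) : ContMap D D.lift := ⟨fun x => (x : WithBot D), .withBot_coe⟩

/-- The counit `down : D_⊥ → D` of lifting; it sends `⊥` to `⊥` and `up x` to `x`. -/
def down (D : Dom) : ContMap D.lift D :=
  ⟨fun x => WithBot.recBotCoe ⊥ (fun x => x) x, .withBot rfl (by simp)⟩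

/-- The injection of `x` tagged with the label `i`. -/
def inject {ι : Type} (D : ι → Dom) (i : ι) : ContMap (D i) (Dom.csum D) :=
  ⟨fun x => ((⟨i, x⟩ : Σ i, D i) : WithBot (Σ i, D i)),
    (ScottContinuous.sigma_mk (δ := fun i => D i) i).comp ScottContinuous.withBot_coe⟩

/-- Case analysis, strict in the analysed component: `⊥ ↦ ⊥` and `(i, x) ↦ f i (r, x)`. -/
def caseFn {ι : Type} {R B : Dom} {D : ι → Dom} (f : ∀ i, ContMap (R.prod (D i)) B) :
    ContMap (R.prod (Dom.csum D)) B :=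
  ⟨fun p => WithBot.recBotCoe (C := fun _ => B) ⊥ (fun x => f x.1 (p.1, x.2)) p.2,
    .fromProd
      (fun r => .withBot rfl (.sigma fun i => by
        change ScottContinuous fun x => f i (r, x)
        fun_prop))
      (fun x => by
        induction x using WithBot.recBotCoe with
        | bot => exact .const _
        | coe x =>
          change ScottContinuous fun r => f x.1 (r, x.2)
          fun_prop)⟩

/-! ## Fixed points and the trace -/

/-- The Kleene chain `g^n ⊥` of a function `g`, as a chain of continuous functions of `g`. -/
def kleene (D : Dom) : ℕ → ContMap (D.fn D) D
  | 0 => ⊥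
  | n + 1 => ⟨fun g => g (kleene D n g), by fun_prop⟩

theorem kleene_mono (D : Dom) : Monotone (kleene D) := by
  refine monotone_nat_of_le_succ fun n => ?_
  induction n with
  | zero => exact bot_le
  | succ n ih => exact fun g => g.cont.monotone (ih g)

theorem directedOn_chain {α : Type} [PartialOrder α] {c : ℕ → α} (h : Monotone c) :
    DirectedOn (· ≤ ·) (Set.range c) := directedOn_range.2 h.directed_le

/-- The supremum of an ascending chain. -/
noncomputable def chainSup {α : Type} [PartialOrder α] [IsDcpo α] (c : ℕ → α) (h : Monotone c) :
    α :=
  (IsDcpo.exists_lub _ (Set.range_nonempty c) (directedOn_chain h)).choose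

theorem isLUB_chainSup {α : Type} [PartialOrder α] [IsDcpo α] (c : ℕ → α) (h : Monotone c) :
    IsLUB (Set.range c) (chainSup c h) :=
  (IsDcpo.exists_lub _ (Set.range_nonempty c) (directedOn_chain h)).choose_spec

/-- The least-fixed-point operator `fix : [D → D] → D`, the supremum of the Kleene chain. -/
noncomputable def fix (D : Dom) : ContMap (D.fn D) D := chainSup (kleene D) (kleene_mono D)

theorem isLUB_fix {D : Dom} (g : ContMap D D) :
    IsLUB (Set.range fun n => kleene D n g) (fix D g) := by
  have := ContMap.isLUB_apply (Set.range_nonempty _) (directedOn_chain (kleene_mono D))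
    (isLUB_chainSup _ (kleene_mono D)) g
  rwa [← Set.range_comp] at this

/-- `fix g` is the least pre-fixed point of `g`, and a fixed point. -/
theorem fix_spec {D : Dom} (g : ContMap D D) :
    IsLeast {x | g x ≤ x} (fix D g) ∧ g (fix D g) = fix D g := by
  have hl := isLUB_fix g
  have hm : Monotone fun n => kleene D n g := fun a b h => kleene_mono D h g
  have hle : ∀ x, g x ≤ x → fix D g ≤ x := by
    intro x hx
    refine hl.2 ?_
    rintro _ ⟨n, rfl⟩
    induction n with
    | zero => exact (bot_le : ⊥ ≤ x)
    | succ n ih => exact (g.cont.monotone ih).trans hx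
  have hpre : g (fix D g) ≤ fix D g := by
    refine (g.cont (Set.range_nonempty _) (directedOn_chain hm) hl).2 ?_
    rintro _ ⟨_, ⟨n, rfl⟩, rfl⟩
    exact hl.1 ⟨n + 1, rfl⟩
  exact ⟨⟨hpre, fun x hx => hle x hx⟩, le_antisymm hpre (hle _ (g.cont.monotone hpre))⟩

/-- The parametrized fixed-point operator: `sfix f a = fix (fun x => f (a, x))`. -/
noncomputable def sfix {A X : Dom} (f : ContMap (A.prod X) X) : ContMap A X :=
  (fix X).comp f.curry

/-- The trace operator: `trace f = π_B ∘ f ∘ ⟨id, sfix (π_X ∘ f)⟩`. -/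
noncomputable def trace {A B X : Dom} (f : ContMap (A.prod X) (B.prod X)) : ContMap A B :=
  ⟨fun a => (f (a, sfix (X := X) ⟨fun p => (f p).2, by fun_prop⟩ a)).1, by fun_prop⟩

/-! ## Locally continuous functors -/

/-- Identities of the category of domains and strict continuous functions. -/
def StrictMap.id (D : Dom) : StrictMap D D := ⟨⟨fun x => x, .id⟩, rfl⟩

/-- Composition of strict continuous functions, in diagrammatic order. -/
def StrictMap.comp {D E F : Dom} (f : StrictMap D E) (g : StrictMap E F) : StrictMap D F :=
  ⟨⟨fun x => g.1 (f.1 x), by fun_prop⟩, by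
    change g.1 (f.1 ⊥) = ⊥
    rw [f.2, g.2]⟩

section Categories

open CategoryTheory

/-- A category whose hom-sets are partially ordered. -/
structure OrdCat where
  Obj : Type 1
  [cat : Category.{0} Obj]
  [ord : ∀ X Y : Obj, PartialOrder (X ⟶ Y)]

attribute [instance] OrdCat.cat OrdCat.ord

/-- Polarities, and also the two aspects of a communication. -/
inductive Pol
  | neg
  | pos

namespace OrdCat

/-- The terminal category. -/
abbrev one : OrdCat where
  Obj := PUnit
  cat := { Hom := fun _ _ => PUnit, id := fun _ => ⟨⟩, comp := fun _ _ => ⟨⟩ }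
  ord _ _ := (inferInstance : PartialOrder PUnit)

/-- `C × 𝒟 × 𝒟`, where `𝒟` is the category of domains and strict continuous functions: the
two new components are the negative and the positive aspect of a type variable. -/
abbrev extend (C : OrdCat) : OrdCat where
  Obj := C.Obj × (Pol → Dom)
  cat :=
    { Hom := fun X Y => (X.1 ⟶ Y.1) × ∀ q, StrictMap (X.2 q) (Y.2 q)
      id := fun X => (𝟙 X.1, fun q => StrictMap.id (X.2 q))
      comp := fun f g => (f.1 ≫ g.1, fun q => (f.2 q).comp (g.2 q))
      id_comp := fun f => Prod.ext (Category.id_comp f.1) rfl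
      comp_id := fun f => Prod.ext (Category.comp_id f.1) rfl
      assoc := fun f g h => Prod.ext (Category.assoc f.1 g.1 h.1) rfl }
  ord X Y := inferInstanceAs (PartialOrder ((X.1 ⟶ Y.1) × ∀ q, StrictMap (X.2 q) (Y.2 q)))

end OrdCat

/-- Locally continuous functors from `C` to the category of domains and strict continuous
functions. Suprema of directed sets of strict continuous functions are computed pointwise, so local
continuity is stated pointwise. -/
structure LFun (C : OrdCat) where
  obj : C.Obj → Dom
  map : ∀ {X Y : C.Obj}, (X ⟶ Y) → StrictMap (obj X) (obj Y)
  map_id : ∀ (X : C.Obj) (x : obj X), (map (𝟙 X)).1 x = x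
  map_comp : ∀ {X Y Z : C.Obj} (f : X ⟶ Y) (g : Y ⟶ Z) (x : obj X),
    (map (f ≫ g)).1 x = (map g).1 ((map f).1 x)
  cont : ∀ (X Y : C.Obj) (x : obj X), ScottContinuous fun f : X ⟶ Y => (map f).1 x

/-- Local continuity may be checked pointwise. -/
theorem ScottContinuous.strictMap_mk {α β γ : Type} [PartialOrder α] [PartialOrder β]
    [PartialOrder γ] [OrderBot β] [OrderBot γ] {f : α → StrictMap β γ}
    (h : ∀ y, ScottContinuous fun x => (f x).1 y) : ScottContinuous f :=
  fun _ hne hd _ ha => StrictMap.isLUB_of_apply fun y => by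
    rw [Set.image_image]; exact h y hne hd ha

namespace LFun

variable {C : OrdCat}

/-- Constant functors. -/
def const (D : Dom) : LFun C where
  obj _ := D
  map _ := StrictMap.id D
  map_id _ _ := rfl
  map_comp _ _ _ := rfl
  cont _ _ _ := .const _

/-- The functor `G_⊥ = (-)_⊥ ∘ G`. -/
def lift (G : LFun C) : LFun C where
  obj X := (G.obj X).lift
  map f := ⟨⟨fun x => WithBot.map (G.map f).1 x, .withBot rfl
    ((G.map f).1.cont.comp .withBot_coe)⟩, rfl⟩
  map_id X x := by
    induction x using WithBot.recBotCoe with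
    | bot => rfl
    | coe x => exact congrArg WithBot.some (G.map_id X x)
  map_comp f g x := by
    induction x using WithBot.recBotCoe with
    | bot => rfl
    | coe x => exact congrArg WithBot.some (G.map_comp f g x)
  cont X Y x := by
    induction x using WithBot.recBotCoe with
    | bot => exact .const _
    | coe x => exact (G.cont X Y x).comp .withBot_coe

/-- Pointwise binary products of functors. -/
def prod (G H : LFun C) : LFun C where
  obj X := (G.obj X).prod (H.obj X)
  map f := ⟨⟨fun x => ((G.map f).1 x.1, (H.map f).1 x.2), by fun_prop⟩,
    Prod.ext (G.map f).2 (H.map f).2⟩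
  map_id X x := Prod.ext (G.map_id X x.1) (H.map_id X x.2)
  map_comp f g x := Prod.ext (G.map_comp f g x.1) (H.map_comp f g x.2)
  cont X Y x := (G.cont X Y x.1).prodMk (H.cont X Y x.2)

/-- Pointwise products of families of functors. -/
def pi {ι : Type} (G : ι → LFun C) : LFun C where
  obj X := Dom.pi fun i => (G i).obj X
  map f := ⟨⟨fun x i => ((G i).map f).1 (x i), .of_pi fun i => by fun_prop⟩,
    funext fun i => ((G i).map f).2⟩
  map_id X x := funext fun i => (G i).map_id X (x i)
  map_comp f g x := funext fun i => (G i).map_comp f g (x i)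
  cont X Y x := .of_pi fun i => (G i).cont X Y (x i)

/-- Pointwise coalesced sums of the lifted functors `(G i)_⊥`. -/
def csum {ι : Type} (G : ι → LFun C) : LFun C where
  obj X := Dom.csum fun i => (G i).obj X
  map {X Y} f := ⟨⟨fun x => WithBot.map (fun s : Σ i, (G i).obj X =>
      (⟨s.1, ((G s.1).map f).1 s.2⟩ : Σ i, (G i).obj Y)) x,
    .withBot rfl (.sigma fun i => (((G i).map f).1.cont.comp
      (.sigma_mk (δ := fun i => (G i).obj Y) i)).comp .withBot_coe)⟩, rfl⟩
  map_id X x := by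
    induction x using WithBot.recBotCoe with
    | bot => rfl
    | coe x => exact congrArg (fun z => WithBot.some (Sigma.mk x.1 z)) ((G x.1).map_id X x.2)
  map_comp f g x := by
    induction x using WithBot.recBotCoe with
    | bot => rfl
    | coe x =>
      exact congrArg (fun z => WithBot.some (Sigma.mk x.1 z)) ((G x.1).map_comp f g x.2)
  cont X Y x := by
    induction x using WithBot.recBotCoe with
    | bot => exact .const _
    | coe x =>
      exact (((G x.1).cont X Y x.2).comp
        (.sigma_mk (δ := fun i => (G i).obj Y) x.1)).comp .withBot_coe

/-- Projection to the aspect `q` of the last type variable. -/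
def last (q : Pol) : LFun C.extend where
  obj X := X.2 q
  map f := f.2 q
  map_id _ _ := rfl
  map_comp _ _ _ := rfl
  cont X Y x := by
    have h : ScottContinuous fun f : (X.1 ⟶ Y.1) × ∀ q, StrictMap (X.2 q) (Y.2 q) =>
        (f.2 q).1 x := by fun_prop
    exact h

/-- Weakening by a new type variable. -/
def weaken (G : LFun C) : LFun C.extend where
  obj X := G.obj X.1
  map f := G.map f.1
  map_id X x := G.map_id X.1 x
  map_comp f g x := G.map_comp f.1 g.1 x
  cont X Y x := by
    have h : ScottContinuous fun f : (X.1 ⟶ Y.1) × ∀ q, StrictMap (X.2 q) (Y.2 q) =>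
        (G.map f.1).1 x := ScottContinuous.fst.comp (G.cont X.1 Y.1 x)
    exact h

theorem mono (G : LFun C) {X Y : C.Obj} {f g : X ⟶ Y} (h : f ≤ g) (x : G.obj X) :
    (G.map f).1 x ≤ (G.map g).1 x := (G.cont X Y x).monotone h

end LFun

/-! ## Inverse limits -/

section Limit

/-- Threads of a chain of domains. -/
abbrev Thread (A : ℕ → Dom) (r : ∀ n, StrictMap (A (n + 1)) (A n)) : Type :=
  {x : ∀ n, A n // ∀ n, (r n).1 (x (n + 1)) = x n}

variable {A : ℕ → Dom} {r : ∀ n, StrictMap (A (n + 1)) (A n)}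

instance : OrderBot (Thread A r) where
  bot := ⟨⊥, fun n => (r n).2⟩
  bot_le x := (bot_le : ⊥ ≤ x.1)

theorem Thread.isLUB_of_apply {s : Set (Thread A r)} {x : Thread A r}
    (h : ∀ n, IsLUB ((fun y : Thread A r => y.1 n) '' s) (x.1 n)) : IsLUB s x :=
  ⟨fun y hy n => (h n).1 ⟨y, hy, rfl⟩, fun z hz n => (h n).2 (by
    rintro _ ⟨y, hy, rfl⟩; exact hz hy n)⟩

theorem Thread.exists_lub (s : Set (Thread A r)) (hs : s.Nonempty) (hd : DirectedOn (· ≤ ·) s) :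
    ∃ x : Thread A r, ∀ n, IsLUB ((fun y : Thread A r => y.1 n) '' s) (x.1 n) := by
  have hdir : ∀ n, DirectedOn (· ≤ ·) ((fun y : Thread A r => y.1 n) '' s) := by
    rintro n _ ⟨y, hy, rfl⟩ _ ⟨z, hz, rfl⟩
    obtain ⟨w, hw, h1, h2⟩ := hd y hy z hz
    exact ⟨_, ⟨w, hw, rfl⟩, h1 n, h2 n⟩
  choose x hx using fun n => IsDcpo.exists_lub _ (hs.image _) (hdir n)
  refine ⟨⟨x, fun n => ?_⟩, hx⟩
  have h := (r n).1.cont (hs.image _) (hdir (n + 1)) (hx (n + 1))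
  rw [Set.image_image] at h
  refine h.unique ?_
  have e : (fun y : Thread A r => (r n).1 (y.1 (n + 1))) = fun y => y.1 n :=
    funext fun y => y.2 n
  exact e ▸ hx n

instance : IsDcpo (Thread A r) :=
  ⟨fun s hs hd => let ⟨x, hx⟩ := Thread.exists_lub s hs hd; ⟨x, Thread.isLUB_of_apply hx⟩⟩

theorem Thread.cont_of_apply {α : Type} [PartialOrder α] {f : α → Thread A r}
    (h : ∀ n, ScottContinuous fun a => (f a).1 n) : ScottContinuous f :=
  fun _ hne hd _ ha => Thread.isLUB_of_apply fun n => by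
    rw [Set.image_image]; exact h n hne hd ha

/-- The inverse limit of a chain of domains. -/
abbrev Dom.lim (A : ℕ → Dom) (r : ∀ n, StrictMap (A (n + 1)) (A n)) : Dom := ⟨Thread A r⟩

theorem Thread.cont_apply (n : ℕ) : ScottContinuous fun x : Thread A r => x.1 n :=
  fun s hs hd x hx => by
    obtain ⟨y, hy⟩ := Thread.exists_lub s hs hd
    rw [hx.unique (Thread.isLUB_of_apply hy)]
    exact hy n

end Limit

/-- Pointwise inverse limits of chains of functors. -/
def LFun.lim {C : OrdCat} (A : C.Obj → ℕ → Dom)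
    (r : ∀ (X : C.Obj) (n : ℕ), StrictMap (A X (n + 1)) (A X n))
    (m : ∀ {X Y : C.Obj}, (X ⟶ Y) → ∀ n, StrictMap (A X n) (A Y n))
    (hr : ∀ {X Y : C.Obj} (f : X ⟶ Y) (n : ℕ) (x : A X (n + 1)),
      (r Y n).1 ((m f (n + 1)).1 x) = (m f n).1 ((r X n).1 x))
    (hid : ∀ (X : C.Obj) (n : ℕ) (x : A X n), (m (𝟙 X) n).1 x = x)
    (hcomp : ∀ {X Y Z : C.Obj} (f : X ⟶ Y) (g : Y ⟶ Z) (n : ℕ) (x : A X n),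
      (m (f ≫ g) n).1 x = (m g n).1 ((m f n).1 x))
    (hcont : ∀ (X Y : C.Obj) (n : ℕ) (x : A X n), ScottContinuous fun f : X ⟶ Y => (m f n).1 x) :
    LFun C where
  obj X := Dom.lim (A X) (r X)
  map {X Y} f := ⟨⟨fun x => ⟨fun n => (m f n).1 (x.1 n), fun n => by rw [hr, x.2]⟩,
    Thread.cont_of_apply fun n => (Thread.cont_apply n).comp (m f n).1.cont⟩,
    Subtype.ext (funext fun n => (m f n).2)⟩
  map_id X x := Subtype.ext (funext fun n => hid X n (x.1 n))
  map_comp f g x := Subtype.ext (funext fun n => hcomp f g n (x.1 n))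
  cont X Y x := Thread.cont_of_apply fun n => hcont X Y n (x.1 n)

/-! ## Canonical solutions of recursive domain equations

`G` is a pair of functors `C × 𝒟 × 𝒟 → 𝒟`. For each `D`, the domain equations
`X q ≅ G q (D, X)`, for both aspects `q`, are solved simultaneously by the inverse limit (the
bilimit) of the chain `1, G (D, 1), G (D, G (D, 1)), …` -/

namespace FIX

variable {C : OrdCat} (G : Pol → LFun C.extend)

/-- The approximations of the solution. -/
def approx (D : C.Obj) (n : ℕ) : Pol → Dom :=
  Nat.rec (fun _ => Dom.unit) (fun _ X q => (G q).obj (D, X)) n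

/-- The action of `G` on families of maps between the variable components. -/
def act (D : C.Obj) {X Y : Pol → Dom} (f : ∀ q, StrictMap (X q) (Y q)) (q : Pol) :
    StrictMap ((G q).obj (D, X)) ((G q).obj (D, Y)) :=
  (G q).map (X := (D, X)) (Y := (D, Y)) (𝟙 D, f)

variable {G} in
theorem act_comp (D : C.Obj) {X Y Z : Pol → Dom} (f : ∀ q, StrictMap (X q) (Y q))
    (g : ∀ q, StrictMap (Y q) (Z q)) (q : Pol) (x) :
    (act G D g q).1 ((act G D f q).1 x) = (act G D (fun q => (f q).comp (g q)) q).1 x := by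
  have := (G q).map_comp (X := (D, X)) (Y := (D, Y)) (Z := (D, Z)) (𝟙 D, f) (𝟙 D, g) x
  rw [act, act, ← this]
  change ((G q).map (X := (D, X)) (Y := (D, Z)) (𝟙 D ≫ 𝟙 D, _)).1 x = _
  rw [Category.comp_id]
  rfl

variable {G} in
theorem act_congr (D : C.Obj) {X Y : Pol → Dom} {f g : ∀ q, StrictMap (X q) (Y q)}
    (h : ∀ q x, (f q).1 x = (g q).1 x) (q : Pol) (x) :
    (act G D f q).1 x = (act G D g q).1 x := by
  rw [show f = g from funext fun q => StrictMap.ext (h q)]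

variable {G} in
theorem act_mono (D : C.Obj) {X Y : Pol → Dom} {f g : ∀ q, StrictMap (X q) (Y q)}
    (h : ∀ q x, (f q).1 x ≤ (g q).1 x) (q : Pol) (x) :
    (act G D f q).1 x ≤ (act G D g q).1 x := by
  have h' : (𝟙 D, f) ≤ (𝟙 D, g) := ⟨le_rfl, h⟩
  exact (G q).mono (X := (D, X)) (Y := (D, Y)) h' x

/-- The comparison maps between the approximations: embeddings for `n ≤ m`, projections
for `m ≤ n`. -/
def step (D : C.Obj) : ∀ (n m : ℕ) (q : Pol), StrictMap (approx G D n q) (approx G D m q)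
  | 0, _, _ => ⊥
  | _ + 1, 0, _ => ⊥
  | n + 1, m + 1, q => act G D (step D n m) q

theorem step_comp_le (D : C.Obj) : ∀ (k n m : ℕ) (q : Pol) (x : approx G D k q),
    (step G D n m q).1 ((step G D k n q).1 x) ≤ (step G D k m q).1 x
  | 0, n, m, q, x => by
    have : (step G D 0 n q).1 x = ⊥ := by cases n <;> rfl
    rw [this, (step G D n m q).2]
    exact bot_le
  | k + 1, 0, m, q, x => by
    have : ∀ y, (step G D 0 m q).1 y = ⊥ := by cases m <;> intro _ <;> rfl
    rw [this]
    exact bot_le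
  | k + 1, n + 1, 0, q, x => le_rfl
  | k + 1, n + 1, m + 1, q, x => by
    refine (act_comp D (step G D k n) (step G D n m) q x).le.trans ?_
    exact act_mono D (fun q x => step_comp_le D k n m q x) q x

theorem step_step (D : C.Obj) : ∀ (n m : ℕ) (q : Pol) (x : approx G D n q),
    (step G D (m + 1) m q).1 ((step G D n (m + 1) q).1 x) = (step G D n m q).1 x
  | 0, m, q, x => by
    have : (step G D 0 m q).1 x = ⊥ := by cases m <;> rfl
    rw [this]
    exact (step G D (m + 1) m q).2
  | n + 1, 0, q, x => rfl
  | n + 1, m + 1, q, x => by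
    refine (act_comp D (step G D n (m + 1)) (step G D (m + 1) m) q x).trans ?_
    exact act_congr D (fun q x => step_step D n m q x) q x

/-- The solution of the domain equations. -/
abbrev obj (D : C.Obj) (q : Pol) : Dom :=
  Dom.lim (fun n => approx G D n q) fun n => step G D (n + 1) n q

/-- The projection from the solution to the `n`-th approximation. -/
def proj (D : C.Obj) (n : ℕ) (q : Pol) : StrictMap (obj G D q) (approx G D n q) :=
  ⟨⟨fun x => x.1 n, Thread.cont_apply n⟩, rfl⟩

/-- The embedding of the `n`-th approximation into the solution. -/
def emb (D : C.Obj) (n : ℕ) (q : Pol) : StrictMap (approx G D n q) (obj G D q) :=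
  ⟨⟨fun x => ⟨fun m => (step G D n m q).1 x, fun m => step_step G D n m q x⟩,
    Thread.cont_of_apply fun m => (step G D n m q).1.cont⟩,
    Subtype.ext (funext fun m => (step G D n m q).2)⟩

/-- The isomorphism `Fold : G (D, FIX) → FIX`. -/
def fold (D : C.Obj) (q : Pol) : StrictMap ((G q).obj (D, obj G D)) (obj G D q) :=
  ⟨⟨fun y => ⟨fun
      | 0 => ⊥
      | n + 1 => (act G D (proj G D n) q).1 y, fun
      | 0 => rfl
      | n + 1 => by
        refine (act_comp D (proj G D (n + 1)) (step G D (n + 1) n) q y).trans ?_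
        exact act_congr D (f := fun q => (proj G D (n + 1) q).comp (step G D (n + 1) n q))
          (g := proj G D n) (fun q x => x.2 n) q y⟩,
    Thread.cont_of_apply fun
      | 0 => .const _
      | n + 1 => (act G D (proj G D n) q).1.cont⟩,
    Subtype.ext (funext fun
      | 0 => rfl
      | n + 1 => (act G D (proj G D n) q).2)⟩

/-- The `n`-th approximation of `Unfold`. -/
def unfoldApprox (D : C.Obj) (q : Pol) (n : ℕ) :
    StrictMap (obj G D q) ((G q).obj (D, obj G D)) :=
  (proj G D (n + 1) q).comp (act G D (emb G D n) q)

theorem unfoldApprox_mono (D : C.Obj) (q : Pol) : Monotone (unfoldApprox G D q) := by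
  refine monotone_nat_of_le_succ fun n x => ?_
  change (act G D (emb G D n) q).1 (x.1 (n + 1)) ≤ (act G D (emb G D (n + 1)) q).1 (x.1 (n + 2))
  rw [← x.2 (n + 1)]
  refine (act_comp D (step G D (n + 1) n) (emb G D n) q (x.1 (n + 2))).le.trans ?_
  exact act_mono D (f := fun q => (step G D (n + 1) n q).comp (emb G D n q))
    (g := emb G D (n + 1)) (fun q y m => step_comp_le G D (n + 1) n m q y) q _

/-- The isomorphism `Unfold : FIX → G (D, FIX)`, inverse to `Fold`. -/
noncomputable def unfold (D : C.Obj) (q : Pol) :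
    StrictMap (obj G D q) ((G q).obj (D, obj G D)) :=
  chainSup (unfoldApprox G D q) (unfoldApprox_mono G D q)

/-- The maps between approximations induced by a morphism of the parameters. -/
def approxMap {D E : C.Obj} (f : D ⟶ E) :
    ∀ (n : ℕ) (q : Pol), StrictMap (approx G D n q) (approx G E n q) := fun n =>
  Nat.rec (motive := fun n => ∀ q, StrictMap (approx G D n q) (approx G E n q))
    (fun _ => ⊥)
    (fun n h q => (G q).map (X := (D, approx G D n)) (Y := (E, approx G E n)) (f, h)) n

theorem approxMap_step {D E : C.Obj} (f : D ⟶ E) : ∀ (n : ℕ) (q : Pol) (x : approx G D (n + 1) q),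
    (step G E (n + 1) n q).1 ((approxMap G f (n + 1) q).1 x) =
      (approxMap G f n q).1 ((step G D (n + 1) n q).1 x)
  | 0, q, x => rfl
  | n + 1, q, x => by
    refine ((G q).map_comp (X := (D, approx G D (n + 1))) (Y := (E, approx G E (n + 1)))
      (Z := (E, approx G E n)) (f, approxMap G f (n + 1)) (𝟙 E, step G E (n + 1) n) x).symm.trans
      (Eq.trans ?_ ((G q).map_comp (X := (D, approx G D (n + 1))) (Y := (D, approx G D n))
        (Z := (E, approx G E n)) (𝟙 D, step G D (n + 1) n) (f, approxMap G f n) x))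
    refine congrArg (fun k => ((G q).map k).1 x) ?_
    refine Prod.ext ((Category.comp_id f).trans (Category.id_comp f).symm) ?_
    exact funext fun q => StrictMap.ext fun x => approxMap_step f n q x

theorem approxMap_id (D : C.Obj) : ∀ (n : ℕ) (q : Pol) (x : approx G D n q),
    (approxMap G (𝟙 D) n q).1 x = x
  | 0, q, x => rfl
  | n + 1, q, x => by
    refine Eq.trans ?_ ((G q).map_id (D, approx G D n) x)
    change ((G q).map (X := (D, _)) (Y := (D, _)) (𝟙 D, _)).1 x = _
    congr 3
    exact Prod.ext rfl (funext fun q => StrictMap.ext fun x => approxMap_id D n q x)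

theorem approxMap_comp {D E F : C.Obj} (f : D ⟶ E) (g : E ⟶ F) :
    ∀ (n : ℕ) (q : Pol) (x : approx G D n q),
    (approxMap G (f ≫ g) n q).1 x = (approxMap G g n q).1 ((approxMap G f n q).1 x)
  | 0, q, x => rfl
  | n + 1, q, x => by
    refine Eq.trans ?_ ((G q).map_comp (X := (D, approx G D n)) (Y := (E, approx G E n))
      (Z := (F, approx G F n)) (f, _) (g, _) x)
    change ((G q).map (X := (D, _)) (Y := (F, _)) (f ≫ g, _)).1 x = _
    congr 3
    exact Prod.ext rfl (funext fun q => StrictMap.ext fun x => approxMap_comp f g n q x)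

theorem approxMap_cont (D E : C.Obj) : ∀ (n : ℕ),
    ScottContinuous fun f : D ⟶ E => approxMap G f n
  | 0 => .const _
  | n + 1 => .of_pi fun q => .strictMap_mk fun x => by
    have h : ScottContinuous fun f : D ⟶ E =>
        (f, approxMap G f n) := ScottContinuous.id.prodMk (approxMap_cont D E n)
    exact ScottContinuous.comp h ((G q).cont (D, approx G D n) (E, approx G E n) x)

end FIX

/-- The locally continuous functor `D ↦ FIX (G (D, -))`. -/
def LFun.fix {C : OrdCat} (G : Pol → LFun C.extend) (q : Pol) : LFun C :=
  LFun.lim (fun D n => FIX.approx G D n q) (fun D n => FIX.step G D (n + 1) n q)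
    (fun f n => FIX.approxMap G f n q) (fun f n x => FIX.approxMap_step G f n q x)
    (fun D n x => FIX.approxMap_id G D n q x) (fun f g n x => FIX.approxMap_comp G f g n q x)
    (fun D E n x => by
      have h : ScottContinuous fun f : D ⟶ E => FIX.approxMap G f n q :=
        (FIX.approxMap_cont G D E n).comp (.eval q)
      fun_prop)

/-! ## Substitution of functors -/

/-- Locally continuous functors from `C` to `E`. They are used for the categories `E` of
environments for type variables. -/
structure OFun (C E : OrdCat) where
  obj : C.Obj → E.Obj
  map : ∀ {X Y : C.Obj}, (X ⟶ Y) → (obj X ⟶ obj Y)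
  map_id : ∀ X : C.Obj, map (𝟙 X) = 𝟙 (obj X)
  map_comp : ∀ {X Y Z : C.Obj} (f : X ⟶ Y) (g : Y ⟶ Z), map (f ≫ g) = map f ≫ map g
  cont : ∀ X Y : C.Obj, ScottContinuous fun f : X ⟶ Y => map f

namespace OFun

variable {C E : OrdCat}

/-- The functor to the terminal category. -/
def toOne : OFun C OrdCat.one where
  obj _ := ⟨⟩
  map _ := ⟨⟩
  map_id _ := rfl
  map_comp _ _ := rfl
  cont X Y := by
    have h : ScottContinuous fun _ : X ⟶ Y => (⟨⟩ : PUnit) := .const _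
    exact h

/-- Pairing of functors. -/
def pair (F : OFun C E) (G : Pol → LFun C) : OFun C E.extend where
  obj X := (F.obj X, fun q => (G q).obj X)
  map f := (F.map f, fun q => (G q).map f)
  map_id X := Prod.ext (F.map_id X) (funext fun q => StrictMap.ext ((G q).map_id X))
  map_comp f g := Prod.ext (F.map_comp f g) (funext fun q => StrictMap.ext ((G q).map_comp f g))
  cont X Y := (F.cont X Y).prodMk (.of_pi fun q => .strictMap_mk fun x => (G q).cont X Y x)

/-- The identity functor. -/
def id (C : OrdCat) : OFun C C where
  obj X := X
  map f := f
  map_id _ := rfl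
  map_comp _ _ := rfl
  cont _ _ := .id

/-- Composition, in diagrammatic order. -/
def comp {B : OrdCat} (F : OFun B C) (G : OFun C E) : OFun B E where
  obj X := G.obj (F.obj X)
  map f := G.map (F.map f)
  map_id X := by rw [F.map_id, G.map_id]
  map_comp f g := by rw [F.map_comp, G.map_comp]
  cont X Y := (F.cont X Y).comp (G.cont _ _)

/-- The first projection. -/
def fst : OFun C.extend C where
  obj X := X.1
  map f := f.1
  map_id _ := rfl
  map_comp _ _ := rfl
  cont _ _ := ScottContinuous.fst

/-- The action of a functor on environments with one more type variable. -/
def ext (F : OFun C E) : OFun C.extend E.extend := pair (fst.comp F) LFun.last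

end OFun

/-- Precomposition with a functor. -/
def LFun.comp {C E : OrdCat} (G : LFun E) (F : OFun C E) : LFun C where
  obj X := G.obj (F.obj X)
  map f := G.map (F.map f)
  map_id X x := by rw [F.map_id, G.map_id]
  map_comp f g x := by rw [F.map_comp, G.map_comp]
  cont X Y x := (F.cont X Y).comp (G.cont _ _ x)

theorem FIX.step_comp {C E : OrdCat} (G : Pol → LFun E.extend) (F : OFun C E) (D : C.Obj) :
    ∀ n m, FIX.step G (F.obj D) n m = FIX.step (fun q => (G q).comp F.ext) D n m
  | 0, _ => rfl
  | _ + 1, 0 => rfl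
  | n + 1, m + 1 => by
    funext q
    refine Eq.trans ?_ (congrArg (fun f => FIX.act (fun q => (G q).comp F.ext) D f q)
      (FIX.step_comp G F D n m))
    exact congrArg (fun f => (G q).map (X := (F.obj D, FIX.approx G (F.obj D) n))
      (Y := (F.obj D, FIX.approx G (F.obj D) m)) (f, FIX.step G (F.obj D) n m)) (F.map_id D).symm

theorem LFun.lim_congr {C : OrdCat} {A : C.Obj → ℕ → Dom}
    {r r' : ∀ (X : C.Obj) (n : ℕ), StrictMap (A X (n + 1)) (A X n)}
    {m : ∀ {X Y : C.Obj}, (X ⟶ Y) → ∀ n, StrictMap (A X n) (A Y n)} {h1 h1' h2 h3 h4} (h : r = r') :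
    LFun.lim A r m h1 h2 h3 h4 = LFun.lim A r' m h1' h2 h3 h4 := by
  subst h; rfl

theorem LFun.fix_comp {C E : OrdCat} (G : Pol → LFun E.extend) (F : OFun C E) (q : Pol) :
    (LFun.fix G q).comp F = LFun.fix (fun q => (G q).comp F.ext) q :=
  LFun.lim_congr (h1 := fun f n x => FIX.approxMap_step G (F.map f) n q x)
    (funext fun D => funext fun n => congrFun (FIX.step_comp G F D (n + 1) n) q)

end Categories

/-! ## Types -/

/-- Type variables: `TVar Ξ p` is the set of variables of polarity `p` in the context `Ξ`. -/
inductive TVar : List Pol → Pol → Type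
  | zero {Ξ : List Pol} {p : Pol} : TVar (p :: Ξ) p
  | succ {Ξ : List Pol} {p r : Pol} : TVar Ξ p → TVar (r :: Ξ) p

/-! Labels of choices and names of channels and variables are natural numbers. Every type variable
in a functional type is bound inside it, and type variables are named by their position. -/

mutual

/-- Functional types. -/
inductive FType : Type
  /-- The type `{a₀ : A₀ ← a₁ : A₁, …, aₙ : Aₙ}` of quoted processes; the channels are named by
  their positions. -/
  | quote (p₀ : Pol) (A₀ : SType [] p₀) (n : ℕ) (p : Fin n → Pol) (A : ∀ i, SType [] (p i)) : FType
  /-- Function types `τ → σ`. -/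
  | arrow (τ σ : FType) : FType

/-- Session types: `SType Ξ p` is the set of `A` with `Ξ ⊢ A type_s^p`. -/
inductive SType : List Pol → Pol → Type
  /-- The unit type `𝟏`. -/
  | one {Ξ : List Pol} : SType Ξ .pos
  /-- Type variables. -/
  | var {Ξ : List Pol} {p : Pol} (α : TVar Ξ p) : SType Ξ p
  /-- Recursive types `ρα.A`. -/
  | recur {Ξ : List Pol} {p : Pol} (A : SType (p :: Ξ) p) : SType Ξ p
  /-- Downshifts `↓A`. -/
  | down {Ξ : List Pol} (A : SType Ξ .neg) : SType Ξ .pos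
  /-- Upshifts `↑A`. -/
  | up {Ξ : List Pol} (A : SType Ξ .pos) : SType Ξ .neg
  /-- Internal choice `⊕{l : A l}`. -/
  | plus {Ξ : List Pol} (L : Finset ℕ) (A : L → SType Ξ .pos) : SType Ξ .pos
  /-- External choice `&{l : A l}`. -/
  | amp {Ξ : List Pol} (L : Finset ℕ) (A : L → SType Ξ .neg) : SType Ξ .neg
  /-- Channel transmission `B ⊗ A`. -/
  | tensor {Ξ : List Pol} (B A : SType Ξ .pos) : SType Ξ .pos
  /-- Channel reception `B ⊸ A`. -/
  | lolly {Ξ : List Pol} (B : SType Ξ .pos) (A : SType Ξ .neg) : SType Ξ .neg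
  /-- Value transmission `τ ∧ A`. -/
  | and {Ξ : List Pol} (τ : FType) (A : SType Ξ .pos) : SType Ξ .pos
  /-- Value reception `τ ⊃ A`. -/
  | imp {Ξ : List Pol} (τ : FType) (A : SType Ξ .neg) : SType Ξ .neg

end

/-- Extension of a renaming under a binder. -/
def TVar.ext {Ξ Θ : List Pol} (ρ : ∀ p, TVar Ξ p → TVar Θ p) {r : Pol} :
    ∀ p, TVar (r :: Ξ) p → TVar (r :: Θ) p
  | _, .zero => .zero
  | _, .succ α => .succ (ρ _ α)

namespace SType

/-- Renaming of type variables. -/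
def rename : ∀ {Ξ Θ : List Pol} {p : Pol}, (∀ p, TVar Ξ p → TVar Θ p) → SType Ξ p → SType Θ p
  | _, _, _, _, .one => .one
  | _, _, _, ρ, .var α => .var (ρ _ α)
  | _, _, _, ρ, .recur A => .recur (A.rename (TVar.ext ρ))
  | _, _, _, ρ, .down A => .down (A.rename ρ)
  | _, _, _, ρ, .up A => .up (A.rename ρ)
  | _, _, _, ρ, .plus L A => .plus L fun l => (A l).rename ρ
  | _, _, _, ρ, .amp L A => .amp L fun l => (A l).rename ρ
  | _, _, _, ρ, .tensor B A => .tensor (B.rename ρ) (A.rename ρ)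
  | _, _, _, ρ, .lolly B A => .lolly (B.rename ρ) (A.rename ρ)
  | _, _, _, ρ, .and τ A => .and τ (A.rename ρ)
  | _, _, _, ρ, .imp τ A => .imp τ (A.rename ρ)

/-- Extension of a substitution under a binder. -/
def ext {Ξ Θ : List Pol} (σ : ∀ p, TVar Ξ p → SType Θ p) {r : Pol} :
    ∀ p, TVar (r :: Ξ) p → SType (r :: Θ) p
  | _, .zero => .var .zero
  | _, .succ α => (σ _ α).rename fun _ => .succ

/-- Simultaneous substitution for type variables. -/
def subst : ∀ {Ξ Θ : List Pol} {p : Pol}, (∀ p, TVar Ξ p → SType Θ p) → SType Ξ p → SType Θ p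
  | _, _, _, _, .one => .one
  | _, _, _, σ, .var α => σ _ α
  | _, _, _, σ, .recur A => .recur (A.subst (SType.ext σ))
  | _, _, _, σ, .down A => .down (A.subst σ)
  | _, _, _, σ, .up A => .up (A.subst σ)
  | _, _, _, σ, .plus L A => .plus L fun l => (A l).subst σ
  | _, _, _, σ, .amp L A => .amp L fun l => (A l).subst σ
  | _, _, _, σ, .tensor B A => .tensor (B.subst σ) (A.subst σ)
  | _, _, _, σ, .lolly B A => .lolly (B.subst σ) (A.subst σ)
  | _, _, _, σ, .and τ A => .and τ (A.subst σ)
  | _, _, _, σ, .imp τ A => .imp τ (A.subst σ)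

/-- The substitution of `B` for the last type variable. -/
def single {Ξ : List Pol} {r : Pol} (B : SType Ξ r) : ∀ p, TVar (r :: Ξ) p → SType Ξ p
  | _, .zero => B
  | _, .succ α => .var α

/-- `[ρα.A/α]A`. -/
def unfold {Ξ : List Pol} {p : Pol} (A : SType (p :: Ξ) p) : SType Ξ p := A.subst (single A.recur)

end SType

/-! ## Denotations of types -/

/-- `⟦Ξ⟧`, the category of environments for the type variables in `Ξ`. -/
def tctx : List Pol → OrdCat
  | [] => OrdCat.one
  | _ :: Ξ => (tctx Ξ).extend

/-- The aspect `q` of a type variable. -/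
def TVar.den : ∀ {Ξ : List Pol} {p : Pol}, TVar Ξ p → Pol → LFun (tctx Ξ)
  | _, _, .zero, q => LFun.last q
  | _, _, .succ α, q => (α.den q).weaken

mutual

/-- The denotation of a functional type. -/
def FType.den : FType → Dom
  | .quote _ A₀ _ _ A =>
    (((Dom.pi fun i => ((A i).den .pos).obj ⟨⟩).prod ((A₀.den .neg).obj ⟨⟩)).fn
      ((Dom.pi fun i => ((A i).den .neg).obj ⟨⟩).prod ((A₀.den .pos).obj ⟨⟩))).lift
  | .arrow τ σ => τ.den.sfn σ.den

/-- `A.den q` is the aspect `⟦A⟧^q` of the denotation of a session type. A type variable stands for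
both aspects of a type, and a recursive type `ρα.A` denotes the pair of domains that solves the two
equations `X q ≅ ⟦A⟧^q (X neg, X pos)` simultaneously, because `⊸` mixes the two aspects. If
`⟦A⟧^q` depends on `X q` only, then its solution is that of the single equation for `q`. -/
def SType.den : ∀ {Ξ : List Pol} {p : Pol}, SType Ξ p → Pol → LFun (tctx Ξ)
  | _, _, .one, .neg => LFun.const Dom.unit
  | _, _, .one, .pos => LFun.const Dom.unit.lift
  | _, _, .var α, q => α.den q
  | _, _, .recur A, q => LFun.fix A.den q
  | _, _, .down A, .neg => A.den .neg
  | _, _, .down A, .pos => (A.den .pos).lift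
  | _, _, .up A, .neg => (A.den .neg).lift
  | _, _, .up A, .pos => A.den .pos
  | _, _, .plus _ A, .neg => LFun.pi fun l => (A l).den .neg
  | _, _, .plus _ A, .pos => LFun.csum fun l => (A l).den .pos
  | _, _, .amp _ A, .neg => LFun.csum fun l => (A l).den .neg
  | _, _, .amp _ A, .pos => LFun.pi fun l => (A l).den .pos
  | _, _, .tensor B A, .neg => (B.den .neg).prod (A.den .neg)
  | _, _, .tensor B A, .pos => ((B.den .pos).prod (A.den .pos)).lift
  | _, _, .lolly B A, .neg => ((B.den .pos).prod (A.den .neg)).lift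
  | _, _, .lolly B A, .pos => (B.den .neg).prod (A.den .pos)
  | _, _, .and _ A, .neg => A.den .neg
  | _, _, .and τ A, .pos => ((LFun.const τ.den).prod (A.den .pos)).lift
  | _, _, .imp τ A, .neg => ((LFun.const τ.den).prod (A.den .neg)).lift
  | _, _, .imp _ A, .pos => A.den .pos

end

/-! ## Denotations and substitution -/

/-- The identity map between equal domains. -/
def Dom.cast {D E : Dom} (h : D = E) : ContMap D E := h ▸ ContMap.id D

/-- The functor `C → ⟦Ξ⟧` with the components `G`. -/
def OFun.env {C : OrdCat} : ∀ (Ξ : List Pol), (∀ p, TVar Ξ p → Pol → LFun C) → OFun C (tctx Ξ)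
  | [], _ => OFun.toOne
  | _ :: Ξ, G => (OFun.env Ξ fun p α => G p α.succ).pair (G _ .zero)

theorem TVar.den_env {C : OrdCat} : ∀ {Ξ : List Pol} {p : Pol} (α : TVar Ξ p) (q : Pol)
    (G : ∀ p, TVar Ξ p → Pol → LFun C), (α.den q).comp (OFun.env Ξ G) = G p α q
  | _, _, .zero, _, _ => rfl
  | _, _, .succ α, q, G => TVar.den_env α q fun p α => G p α.succ

theorem OFun.env_comp {B C : OrdCat} (F : OFun B C) : ∀ (Ξ : List Pol)
    (G : ∀ p, TVar Ξ p → Pol → LFun C),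
    F.comp (OFun.env Ξ G) = OFun.env Ξ fun p α q => (G p α q).comp F
  | [], _ => rfl
  | _ :: Ξ, G => congrArg (fun H => OFun.pair H fun q => (G _ .zero q).comp F)
      (OFun.env_comp F Ξ fun p α => G p α.succ)

theorem OFun.env_id : ∀ Ξ : List Pol, OFun.env Ξ (fun _ α q => α.den q) = OFun.id (tctx Ξ)
  | [] => rfl
  | _ :: Ξ => by
    have h := (OFun.env_comp (OFun.fst (C := tctx Ξ)) Ξ fun _ α q => α.den q).symm
    rw [OFun.env_id Ξ] at h
    exact congrArg (fun H => OFun.pair H LFun.last) h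

theorem OFun.env_ext {C : OrdCat} (r : Pol) (Ξ : List Pol) (G : ∀ p, TVar Ξ p → Pol → LFun C)
    (G' : ∀ p, TVar (r :: Ξ) p → Pol → LFun C.extend) (h0 : ∀ q, G' r .zero q = LFun.last q)
    (h1 : ∀ p α q, G' p (.succ α) q = (G p α q).weaken) :
    OFun.env (r :: Ξ) G' = (OFun.env Ξ G).ext := by
  have e1 : (fun p α => G' p (TVar.succ α)) = fun p α q => (G p α q).comp OFun.fst := by
    funext p α q; exact h1 p α q
  have e2 : G' r .zero = LFun.last := funext h0
  change OFun.pair (OFun.env Ξ fun p α => G' p (.succ α)) (G' r .zero) =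
    OFun.pair (OFun.fst.comp (OFun.env Ξ G)) LFun.last
  rw [e1, e2, OFun.env_comp]

/-- The denotation of a renamed type. -/
theorem SType.den_rename : ∀ {Ξ Θ : List Pol} {p : Pol} (ρ : ∀ p, TVar Ξ p → TVar Θ p)
    (A : SType Ξ p) (q : Pol),
    (A.rename ρ).den q = (A.den q).comp (OFun.env Ξ fun _ α q => (ρ _ α).den q)
  | _, _, _, _, .one, .neg => rfl
  | _, _, _, _, .one, .pos => rfl
  | _, _, _, ρ, .var α, q => (TVar.den_env α q fun _ α q => (ρ _ α).den q).symm
  | _, _, _, ρ, .recur A, q => by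
    have h := fun q => (SType.den_rename (TVar.ext ρ) A q).trans (congrArg (A.den q).comp
      (OFun.env_ext _ _ (fun _ α q => (ρ _ α).den q) _ (fun _ => rfl) (fun _ _ _ => rfl)))
    exact (congrArg (fun G => LFun.fix G q) (funext h)).trans (LFun.fix_comp A.den _ q).symm
  | _, _, _, ρ, .down A, .neg => SType.den_rename ρ A .neg
  | _, _, _, ρ, .down A, .pos => congrArg LFun.lift (SType.den_rename ρ A .pos)
  | _, _, _, ρ, .up A, .neg => congrArg LFun.lift (SType.den_rename ρ A .neg)
  | _, _, _, ρ, .up A, .pos => SType.den_rename ρ A .pos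
  | _, _, _, ρ, .plus _ A, .neg =>
    congrArg LFun.pi (funext fun l => SType.den_rename ρ (A l) .neg)
  | _, _, _, ρ, .plus _ A, .pos =>
    congrArg LFun.csum (funext fun l => SType.den_rename ρ (A l) .pos)
  | _, _, _, ρ, .amp _ A, .neg =>
    congrArg LFun.csum (funext fun l => SType.den_rename ρ (A l) .neg)
  | _, _, _, ρ, .amp _ A, .pos =>
    congrArg LFun.pi (funext fun l => SType.den_rename ρ (A l) .pos)
  | _, _, _, ρ, .tensor B A, .neg =>
    congrArg₂ LFun.prod (SType.den_rename ρ B .neg) (SType.den_rename ρ A .neg)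
  | _, _, _, ρ, .tensor B A, .pos => congrArg LFun.lift
    (congrArg₂ LFun.prod (SType.den_rename ρ B .pos) (SType.den_rename ρ A .pos))
  | _, _, _, ρ, .lolly B A, .neg => congrArg LFun.lift
    (congrArg₂ LFun.prod (SType.den_rename ρ B .pos) (SType.den_rename ρ A .neg))
  | _, _, _, ρ, .lolly B A, .pos =>
    congrArg₂ LFun.prod (SType.den_rename ρ B .neg) (SType.den_rename ρ A .pos)
  | _, _, _, ρ, .and _ A, .neg => SType.den_rename ρ A .neg
  | _, _, _, ρ, .and τ A, .pos => congrArg (fun G => ((LFun.const τ.den).prod G).lift)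
    (SType.den_rename ρ A .pos)
  | _, _, _, ρ, .imp τ A, .neg => congrArg (fun G => ((LFun.const τ.den).prod G).lift)
    (SType.den_rename ρ A .neg)
  | _, _, _, ρ, .imp _ A, .pos => SType.den_rename ρ A .pos

theorem LFun.comp_env_succ {Ξ : List Pol} {r : Pol} (G : LFun (tctx Ξ)) :
    G.comp (OFun.env Ξ fun _ α q => (TVar.succ (r := r) α).den q) = G.weaken := by
  have h := OFun.env_comp (OFun.fst (C := tctx Ξ)) Ξ fun _ α q => α.den q
  rw [OFun.env_id] at h
  exact (congrArg G.comp h).symm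

/-- The denotation of a substitution instance. -/
theorem SType.den_subst : ∀ {Ξ Θ : List Pol} {p : Pol} (σ : ∀ p, TVar Ξ p → SType Θ p)
    (A : SType Ξ p) (q : Pol),
    (A.subst σ).den q = (A.den q).comp (OFun.env Ξ fun _ α q => (σ _ α).den q)
  | _, _, _, _, .one, .neg => rfl
  | _, _, _, _, .one, .pos => rfl
  | _, _, _, σ, .var α, q => (TVar.den_env α q fun _ α q => (σ _ α).den q).symm
  | _, _, _, σ, .recur A, q => by
    have h := fun q => (SType.den_subst (SType.ext σ) A q).trans (congrArg (A.den q).comp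
      (OFun.env_ext _ _ (fun _ α q => (σ _ α).den q) _ (fun _ => rfl) (fun _ α q =>
        (SType.den_rename _ (σ _ α) q).trans (LFun.comp_env_succ _))))
    exact (congrArg (fun G => LFun.fix G q) (funext h)).trans (LFun.fix_comp A.den _ q).symm
  | _, _, _, σ, .down A, .neg => SType.den_subst σ A .neg
  | _, _, _, σ, .down A, .pos => congrArg LFun.lift (SType.den_subst σ A .pos)
  | _, _, _, σ, .up A, .neg => congrArg LFun.lift (SType.den_subst σ A .neg)
  | _, _, _, σ, .up A, .pos => SType.den_subst σ A .pos
  | _, _, _, σ, .plus _ A, .neg =>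
    congrArg LFun.pi (funext fun l => SType.den_subst σ (A l) .neg)
  | _, _, _, σ, .plus _ A, .pos =>
    congrArg LFun.csum (funext fun l => SType.den_subst σ (A l) .pos)
  | _, _, _, σ, .amp _ A, .neg =>
    congrArg LFun.csum (funext fun l => SType.den_subst σ (A l) .neg)
  | _, _, _, σ, .amp _ A, .pos =>
    congrArg LFun.pi (funext fun l => SType.den_subst σ (A l) .pos)
  | _, _, _, σ, .tensor B A, .neg =>
    congrArg₂ LFun.prod (SType.den_subst σ B .neg) (SType.den_subst σ A .neg)
  | _, _, _, σ, .tensor B A, .pos => congrArg LFun.lift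
    (congrArg₂ LFun.prod (SType.den_subst σ B .pos) (SType.den_subst σ A .pos))
  | _, _, _, σ, .lolly B A, .neg => congrArg LFun.lift
    (congrArg₂ LFun.prod (SType.den_subst σ B .pos) (SType.den_subst σ A .neg))
  | _, _, _, σ, .lolly B A, .pos =>
    congrArg₂ LFun.prod (SType.den_subst σ B .neg) (SType.den_subst σ A .pos)
  | _, _, _, σ, .and _ A, .neg => SType.den_subst σ A .neg
  | _, _, _, σ, .and τ A, .pos => congrArg (fun G => ((LFun.const τ.den).prod G).lift)
    (SType.den_subst σ A .pos)
  | _, _, _, σ, .imp τ A, .neg => congrArg (fun G => ((LFun.const τ.den).prod G).lift)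
    (SType.den_subst σ A .neg)
  | _, _, _, σ, .imp _ A, .pos => SType.den_subst σ A .pos

/-- The aspect `⟦A⟧^q` of a closed session type, as a domain. -/
def SType.dom {p : Pol} (A : SType [] p) (q : Pol) : Dom := (A.den q).obj ⟨⟩

/-- `⟦[ρα.A/α]A⟧ = ⟦A⟧ (FIX ⟦A⟧)`. -/
theorem SType.dom_unfold {p : Pol} (A : SType [p] p) (q : Pol) :
    A.unfold.dom q = (A.den q).obj (⟨⟩, FIX.obj A.den ⟨⟩) := by
  have h := SType.den_subst (SType.single A.recur) A q
  exact congrArg (fun G => G.obj ⟨⟩) h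

/-- The isomorphism `Fold : ⟦[ρα.A/α]A⟧^q → ⟦ρα.A⟧^q`. -/
def SType.fold {p : Pol} (A : SType [p] p) (q : Pol) : ContMap (A.unfold.dom q) (A.recur.dom q) :=
  (FIX.fold A.den ⟨⟩ q).1.comp (Dom.cast (A.dom_unfold q))

/-- The isomorphism `Unfold : ⟦ρα.A⟧^q → ⟦[ρα.A/α]A⟧^q`. -/
noncomputable def SType.unfoldMap {p : Pol} (A : SType [p] p) (q : Pol) :
    ContMap (A.recur.dom q) (A.unfold.dom q) :=
  (Dom.cast (A.dom_unfold q).symm).comp (FIX.unfold A.den ⟨⟩ q).1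

/-! ## Contexts -/

/-- Contexts assign types to names. -/
abbrev Ctx (T : Type) : Type := ℕ → Option T

namespace Ctx

variable {T : Type}

/-- The empty context. -/
def empty : Ctx T := fun _ => none

/-- The context `Δ, a : A`. -/
def ext (Δ : Ctx T) (a : ℕ) (A : T) : Ctx T := fun n => if n = a then some A else Δ n

/-- The context `Δ₁, Δ₂`. -/
def union (Δ₁ Δ₂ : Ctx T) : Ctx T := fun n => (Δ₁ n).or (Δ₂ n)

/-- The domains of `Δ₁` and `Δ₂` are disjoint. -/
def Disj (Δ₁ Δ₂ : Ctx T) : Prop := ∀ n, Δ₁ n = none ∨ Δ₂ n = none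

/-- The context `x₀ : A₀, x₁ : A₁, …`. -/
def ofFin : ∀ {n : ℕ}, (Fin n → ℕ) → (Fin n → T) → Ctx T
  | 0, _, _ => empty
  | _ + 1, x, A => (ofFin (fun i => x i.succ) fun i => A i.succ).ext (x 0) (A 0)

variable (I : T → Dom)

/-- The component of the denotation of a context at one name. -/
def optDom : Option T → Dom
  | none => Dom.unit
  | some A => I A

/-- The denotation of a context: the product of the denotations of its types, indexed by their
names. Names that do not occur in the context contribute a one-point factor. -/
def dom (Δ : Ctx T) : Dom := Dom.pi fun n => optDom I (Δ n)

/-- Projection from a conditional component. -/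
def iteFst {P : Prop} (d : Decidable P) (o₁ o₂ : Option T) :
    ContMap (optDom I (if P then o₁ else o₂)) (optDom I o₁) :=
  match d with
  | isTrue _ => ContMap.id _
  | isFalse _ => ⊥

/-- Projection from a conditional component. -/
def iteSnd {P : Prop} (d : Decidable P) (o₁ o₂ : Option T) :
    ContMap (optDom I (if P then o₁ else o₂)) (optDom I o₂) :=
  match d with
  | isTrue _ => ⊥
  | isFalse _ => ContMap.id _

/-- Pairing into a conditional component. -/
def iteMk {P : Prop} (d : Decidable P) (o₁ o₂ : Option T) :
    ContMap ((optDom I o₁).prod (optDom I o₂)) (optDom I (if P then o₁ else o₂)) :=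
  match d with
  | isTrue _ => ⟨fun x => x.1, ScottContinuous.fst⟩
  | isFalse _ => ⟨fun x => x.2, ScottContinuous.snd⟩

variable {I}

/-- The projection `⟦Δ, a : A⟧ → ⟦A⟧`. -/
def get {Δ : Ctx T} {a : ℕ} {A : T} : ContMap ((Δ.ext a A).dom I) (I A) :=
  ⟨fun δ => iteFst I (instDecidableEqNat a a) (some A) (Δ a) (δ a),
    (ScottContinuous.eval (δ := fun n => optDom I (Δ.ext a A n)) a).comp (ContMap.cont _)⟩

/-- The projection `⟦Δ, a : A⟧ → ⟦Δ⟧`. -/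
def drop {Δ : Ctx T} {a : ℕ} {A : T} : ContMap ((Δ.ext a A).dom I) (Δ.dom I) :=
  ⟨fun δ n => iteSnd I (instDecidableEqNat n a) (some A) (Δ n) (δ n), .of_pi fun n =>
    (ScottContinuous.eval (δ := fun n => optDom I (Δ.ext a A n)) n).comp (ContMap.cont _)⟩

/-- The isomorphism `⟦Δ⟧ × ⟦A⟧ → ⟦Δ, a : A⟧`. -/
def mk {Δ : Ctx T} {a : ℕ} {A : T} : ContMap ((Δ.dom I).prod (I A)) ((Δ.ext a A).dom I) :=
  ⟨fun x n => iteMk I (instDecidableEqNat n a) (some A) (Δ n) (x.2, x.1 n), .of_pi fun n =>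
    (ScottContinuous.snd.prodMk (ScottContinuous.fst.comp
      (ScottContinuous.eval (δ := fun n => optDom I (Δ n)) n))).comp (ContMap.cont _)⟩

variable (I) in
/-- Projection from a component of a union. -/
def orFst : ∀ o₁ o₂ : Option T, ContMap (optDom I (o₁.or o₂)) (optDom I o₁)
  | none, _ => ⊥
  | some _, _ => ContMap.id _

variable (I) in
/-- Projection from a component of a union. -/
def orSnd : ∀ o₁ o₂ : Option T, ContMap (optDom I (o₁.or o₂)) (optDom I o₂)
  | none, _ => ContMap.id _
  | some _, _ => ⊥

variable (I) in
/-- Pairing into a component of a union. -/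
def orMk : ∀ o₁ o₂ : Option T,
    ContMap ((optDom I o₁).prod (optDom I o₂)) (optDom I (o₁.or o₂))
  | none, _ => ⟨fun x => x.2, ScottContinuous.snd⟩
  | some _, _ => ⟨fun x => x.1, ScottContinuous.fst⟩

/-- The projection `⟦Δ₁, Δ₂⟧ → ⟦Δ₁⟧`. -/
def left {Δ₁ Δ₂ : Ctx T} : ContMap ((Δ₁.union Δ₂).dom I) (Δ₁.dom I) :=
  ⟨fun δ n => orFst I (Δ₁ n) (Δ₂ n) (δ n), .of_pi fun n =>
    (ScottContinuous.eval (δ := fun n => optDom I (Δ₁.union Δ₂ n)) n).comp (ContMap.cont _)⟩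

/-- The projection `⟦Δ₁, Δ₂⟧ → ⟦Δ₂⟧`. -/
def right {Δ₁ Δ₂ : Ctx T} : ContMap ((Δ₁.union Δ₂).dom I) (Δ₂.dom I) :=
  ⟨fun δ n => orSnd I (Δ₁ n) (Δ₂ n) (δ n), .of_pi fun n =>
    (ScottContinuous.eval (δ := fun n => optDom I (Δ₁.union Δ₂ n)) n).comp (ContMap.cont _)⟩

/-- The isomorphism `⟦Δ₁⟧ × ⟦Δ₂⟧ → ⟦Δ₁, Δ₂⟧`. -/
def join {Δ₁ Δ₂ : Ctx T} : ContMap ((Δ₁.dom I).prod (Δ₂.dom I)) ((Δ₁.union Δ₂).dom I) :=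
  ⟨fun x n => orMk I (Δ₁ n) (Δ₂ n) (x.1 n, x.2 n), .of_pi fun n =>
    ((ScottContinuous.fst.comp
      (ScottContinuous.eval (δ := fun n => optDom I (Δ₁ n)) n)).prodMk (ScottContinuous.snd.comp
      (ScottContinuous.eval (δ := fun n => optDom I (Δ₂ n)) n))).comp (ContMap.cont _)⟩

/-- The isomorphism `⟦x₀ : A₀, x₁ : A₁, …⟧ → ∏ i, ⟦Aᵢ⟧`. -/
def toFin : ∀ {n : ℕ} {x : Fin n → ℕ} {A : Fin n → T},
    ContMap ((ofFin x A).dom I) (Dom.pi fun i => I (A i))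
  | 0, _, _ => ⊥
  | _ + 1, _, _ => ⟨fun δ => Fin.cons (get δ) (toFin (drop δ)), .of_pi fun i => by
      refine Fin.cases ?_ (fun j => ?_) i
      · exact get.cont
      · simp only [Fin.cons_succ]
        exact ((drop.cont).comp toFin.cont).comp
          (ScottContinuous.eval (δ := fun j => I (_ : T)) j)⟩

/-- The isomorphism `∏ i, ⟦Aᵢ⟧ → ⟦x₀ : A₀, x₁ : A₁, …⟧`. -/
def fromFin : ∀ {n : ℕ} {x : Fin n → ℕ} {A : Fin n → T},
    ContMap (Dom.pi fun i => I (A i)) ((ofFin x A).dom I)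
  | 0, _, _ => ⊥
  | _ + 1, _, A => ⟨fun δ => mk (fromFin (fun i => δ i.succ), δ 0),
      (((ScottContinuous.of_pi fun i => ScottContinuous.eval (δ := fun i => I (A i)) i.succ).comp
        fromFin.cont).prodMk (ScottContinuous.eval (δ := fun i => I (A i)) 0)).comp mk.cont⟩

end Ctx

/-! ## Terms and processes -/

/-- Closed session types of either polarity. -/
abbrev CType : Type := Σ p, SType [] p

/-- The aspect `⟦A⟧^q` of a closed session type. -/
abbrev CType.dom (q : Pol) (A : CType) : Dom := A.2.dom q

/-- Structural contexts `Ψ` of functional variables. -/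
abbrev FCtx : Type := Ctx FType

/-- Linear contexts `Δ` of channels. -/
abbrev SCtx : Type := Ctx CType

mutual

/-- Typing derivations `Ψ ⊩ M : τ` of functional terms. -/
inductive Term : FCtx → FType → Type
  /-- A quoted process `a ← {P} ← x₁, …, xₙ`. -/
  | quote {Ψ : FCtx} {p₀ : Pol} {A₀ : SType [] p₀} {n : ℕ} {p : Fin n → Pol}
      {A : ∀ i, SType [] (p i)} (a : ℕ) (x : Fin n → ℕ) (hx : Function.Injective x)
      (ha : ∀ i, x i ≠ a) (P : Proc Ψ (Ctx.ofFin x fun i => ⟨p i, A i⟩) a ⟨p₀, A₀⟩) :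
      Term Ψ (.quote p₀ A₀ n p A)
  /-- A variable `x`. -/
  | var {Ψ : FCtx} {x : ℕ} {τ : FType} (hx : Ψ x = none) : Term (Ψ.ext x τ) τ
  /-- A fixed point `fix x.M`. -/
  | fix {Ψ : FCtx} {x : ℕ} {τ : FType} (hx : Ψ x = none) (M : Term (Ψ.ext x τ) τ) : Term Ψ τ
  /-- An abstraction `λx : τ.M`. -/
  | lam {Ψ : FCtx} {x : ℕ} {τ σ : FType} (hx : Ψ x = none) (M : Term (Ψ.ext x τ) σ) :
      Term Ψ (.arrow τ σ)
  /-- An application `M N`. -/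
  | app {Ψ : FCtx} {τ σ : FType} (M : Term Ψ (.arrow τ σ)) (N : Term Ψ τ) : Term Ψ σ

/-- Typing derivations `Ψ; Δ ⊢ P :: c : C` of processes. The side conditions say that the names in
`Δ, c : C` are pairwise distinct in the conclusion of every rule. -/
inductive Proc : FCtx → SCtx → ℕ → CType → Type
  /-- Forwarding `b → a`, from `a` to `b`. -/
  | fwd {Ψ : FCtx} {a b : ℕ} {A : CType} (hab : a ≠ b) : Proc Ψ (Ctx.empty.ext a A) b A
  /-- Composition `a ← P; Q` along a private channel `a`. -/
  | cut {Ψ : FCtx} {Δ₁ Δ₂ : SCtx} {a c : ℕ} {A C : CType} (h₁₂ : Δ₁.Disj Δ₂) (ha : Δ₂ a = none)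
      (hc : Δ₁ c = none) (P : Proc Ψ Δ₁ a A) (Q : Proc Ψ (Δ₂.ext a A) c C) :
      Proc Ψ (Δ₁.union Δ₂) c C
  /-- `close a`. -/
  | oneR {Ψ : FCtx} {a : ℕ} : Proc Ψ Ctx.empty a ⟨_, .one⟩
  /-- `wait a; P`. -/
  | oneL {Ψ : FCtx} {Δ : SCtx} {a c : ℕ} {C : CType} (ha : Δ a = none) (hac : a ≠ c)
      (P : Proc Ψ Δ c C) : Proc Ψ (Δ.ext a ⟨_, .one⟩) c C
  /-- `send a shift; P`, for a downshift. -/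
  | downR {Ψ : FCtx} {Δ : SCtx} {a : ℕ} {A : SType [] .neg} (P : Proc Ψ Δ a ⟨_, A⟩) :
      Proc Ψ Δ a ⟨_, .down A⟩
  /-- `shift ← recv a; P`, for a downshift. -/
  | downL {Ψ : FCtx} {Δ : SCtx} {a c : ℕ} {A : SType [] .neg} {C : CType} (ha : Δ a = none)
      (P : Proc Ψ (Δ.ext a ⟨_, A⟩) c C) : Proc Ψ (Δ.ext a ⟨_, .down A⟩) c C
  /-- `shift ← recv a; P`, for an upshift. -/
  | upR {Ψ : FCtx} {Δ : SCtx} {a : ℕ} {A : SType [] .pos} (P : Proc Ψ Δ a ⟨_, A⟩) :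
      Proc Ψ Δ a ⟨_, .up A⟩
  /-- `send a shift; P`, for an upshift. -/
  | upL {Ψ : FCtx} {Δ : SCtx} {a c : ℕ} {A : SType [] .pos} {C : CType} (ha : Δ a = none)
      (P : Proc Ψ (Δ.ext a ⟨_, A⟩) c C) : Proc Ψ (Δ.ext a ⟨_, .up A⟩) c C
  /-- `a.k; P`, for an internal choice. -/
  | plusR {Ψ : FCtx} {Δ : SCtx} {a : ℕ} {L : Finset ℕ} {A : L → SType [] .pos} (k : L)
      (P : Proc Ψ Δ a ⟨_, A k⟩) : Proc Ψ Δ a ⟨_, .plus L A⟩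
  /-- `case a {l ⇒ P l}`, for an internal choice. -/
  | plusL {Ψ : FCtx} {Δ : SCtx} {a c : ℕ} {L : Finset ℕ} {A : L → SType [] .pos} {C : CType}
      (ha : Δ a = none) (hac : a ≠ c) (hc : Δ c = none)
      (P : ∀ l : L, Proc Ψ (Δ.ext a ⟨_, A l⟩) c C) : Proc Ψ (Δ.ext a ⟨_, .plus L A⟩) c C
  /-- `case a {l ⇒ P l}`, for an external choice. -/
  | ampR {Ψ : FCtx} {Δ : SCtx} {a : ℕ} {L : Finset ℕ} {A : L → SType [] .neg} (ha : Δ a = none)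
      (P : ∀ l : L, Proc Ψ Δ a ⟨_, A l⟩) : Proc Ψ Δ a ⟨_, .amp L A⟩
  /-- `a.k; P`, for an external choice. -/
  | ampL {Ψ : FCtx} {Δ : SCtx} {a c : ℕ} {L : Finset ℕ} {A : L → SType [] .neg} {C : CType}
      (ha : Δ a = none) (k : L) (P : Proc Ψ (Δ.ext a ⟨_, A k⟩) c C) :
      Proc Ψ (Δ.ext a ⟨_, .amp L A⟩) c C
  /-- `send a b; P`, for `B ⊗ A`. -/
  | tensorR {Ψ : FCtx} {Δ : SCtx} {a b : ℕ} {B A : SType [] .pos} (hb : Δ b = none) (hab : a ≠ b)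
      (P : Proc Ψ Δ a ⟨_, A⟩) : Proc Ψ (Δ.ext b ⟨_, B⟩) a ⟨_, .tensor B A⟩
  /-- `b ← recv a; P`, for `B ⊗ A`. -/
  | tensorL {Ψ : FCtx} {Δ : SCtx} {a b c : ℕ} {B A : SType [] .pos} {C : CType} (ha : Δ a = none)
      (hb : Δ b = none) (hab : a ≠ b) (P : Proc Ψ ((Δ.ext a ⟨_, A⟩).ext b ⟨_, B⟩) c C) :
      Proc Ψ (Δ.ext a ⟨_, .tensor B A⟩) c C
  /-- `b ← recv a; P`, for `B ⊸ A`. -/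
  | lollyR {Ψ : FCtx} {Δ : SCtx} {a b : ℕ} {B : SType [] .pos} {A : SType [] .neg}
      (hb : Δ b = none) (P : Proc Ψ (Δ.ext b ⟨_, B⟩) a ⟨_, A⟩) : Proc Ψ Δ a ⟨_, .lolly B A⟩
  /-- `send a b; P`, for `B ⊸ A`. -/
  | lollyL {Ψ : FCtx} {Δ : SCtx} {a b c : ℕ} {B : SType [] .pos} {A : SType [] .neg} {C : CType}
      (ha : Δ a = none) (hb : Δ b = none) (hab : a ≠ b) (hbc : b ≠ c)
      (P : Proc Ψ (Δ.ext a ⟨_, A⟩) c C) :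
      Proc Ψ ((Δ.ext b ⟨_, B⟩).ext a ⟨_, .lolly B A⟩) c C
  /-- `send a M; P`, for `τ ∧ A`. -/
  | andR {Ψ : FCtx} {Δ : SCtx} {a : ℕ} {τ : FType} {A : SType [] .pos} (M : Term Ψ τ)
      (P : Proc Ψ Δ a ⟨_, A⟩) : Proc Ψ Δ a ⟨_, .and τ A⟩
  /-- `x ← recv a; P`, for `τ ∧ A`. -/
  | andL {Ψ : FCtx} {Δ : SCtx} {a c x : ℕ} {τ : FType} {A : SType [] .pos} {C : CType}
      (ha : Δ a = none) (hx : Ψ x = none) (P : Proc (Ψ.ext x τ) (Δ.ext a ⟨_, A⟩) c C) :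
      Proc Ψ (Δ.ext a ⟨_, .and τ A⟩) c C
  /-- `x ← recv a; P`, for `τ ⊃ A`. -/
  | impR {Ψ : FCtx} {Δ : SCtx} {a x : ℕ} {τ : FType} {A : SType [] .neg} (hx : Ψ x = none)
      (P : Proc (Ψ.ext x τ) Δ a ⟨_, A⟩) : Proc Ψ Δ a ⟨_, .imp τ A⟩
  /-- `send a M; P`, for `τ ⊃ A`. -/
  | impL {Ψ : FCtx} {Δ : SCtx} {a c : ℕ} {τ : FType} {A : SType [] .neg} {C : CType}
      (ha : Δ a = none) (M : Term Ψ τ) (P : Proc Ψ (Δ.ext a ⟨_, A⟩) c C) :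
      Proc Ψ (Δ.ext a ⟨_, .imp τ A⟩) c C
  /-- `send a unfold; P` for a positive and `unfold ← recv a; P` for a negative recursive type. -/
  | recurR {Ψ : FCtx} {Δ : SCtx} {a : ℕ} {p : Pol} {A : SType [p] p}
      (P : Proc Ψ Δ a ⟨_, A.unfold⟩) : Proc Ψ Δ a ⟨_, .recur A⟩
  /-- `unfold ← recv a; P` for a positive and `send a unfold; P` for a negative recursive type. -/
  | recurL {Ψ : FCtx} {Δ : SCtx} {a c : ℕ} {p : Pol} {A : SType [p] p} {C : CType}
      (ha : Δ a = none) (P : Proc Ψ (Δ.ext a ⟨_, A.unfold⟩) c C) :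
      Proc Ψ (Δ.ext a ⟨_, .recur A⟩) c C
  /-- An unquoted process `a ← {M} ← x₁, …, xₙ`. -/
  | unquote {Ψ : FCtx} {p₀ : Pol} {A₀ : SType [] p₀} {n : ℕ} {p : Fin n → Pol}
      {A : ∀ i, SType [] (p i)} (a : ℕ) (x : Fin n → ℕ) (hx : Function.Injective x)
      (ha : ∀ i, x i ≠ a) (M : Term Ψ (.quote p₀ A₀ n p A)) :
      Proc Ψ (Ctx.ofFin x fun i => ⟨p i, A i⟩) a ⟨p₀, A₀⟩

end

/-! ## Denotations of terms and processes -/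

/-- `⟦Ψ⟧`. -/
abbrev FCtx.dom (Ψ : FCtx) : Dom := Ctx.dom FType.den Ψ

/-- The aspect `⟦Δ⟧^q`. -/
abbrev SCtx.dom (Δ : SCtx) (q : Pol) : Dom := Ctx.dom (CType.dom q) Δ

/-- `⟦Δ ⊢ c : C⟧ = [⟦Δ⟧⁺ × ⟦C⟧⁻ → ⟦Δ⟧⁻ × ⟦C⟧⁺]`. -/
abbrev procDom (Δ : SCtx) (C : CType) : Dom :=
  ((Δ.dom .pos).prod (C.dom .neg)).fn ((Δ.dom .neg).prod (C.dom .pos))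

/-! ### Semantic clauses

Each clause is a continuous function of an environment `u` (in `U`), of the incoming communications
on the unaffected channels `δ` (in `Dp`), on the affected channels `a` and `b`, and, if `a` is a used
channel, on the offered channel `c`. The result consists of the outgoing communications on the same
channels. The suffixes `p` and `m` stand for the positive and the negative aspects. -/

namespace Clause

variable {U T S Dp Dm Ap Am Bp Bm Cp Cm : Dom}

open Classical in
/-- Abstraction: `u ↦ strict (v ↦ f (u, v))`. -/
noncomputable def lam (f : ContMap (U.prod T) S) : ContMap U (T.sfn S) :=
  ⟨fun u => ⟨strictFn (.id T) (f.curry u), if_pos rfl⟩, .strictMap_mk fun v => by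
    change ScottContinuous fun u => if v = ⊥ then ⊥ else f (u, v)
    by_cases h : v = ⊥
    · simp only [h, if_true]; exact .const _
    · simp only [h, if_false]; fun_prop⟩

/-- Application. -/
def app (f : ContMap U (T.sfn S)) (g : ContMap U T) : ContMap U S :=
  ⟨fun u => (f u).1 (g u), by fun_prop⟩

/-- Close. -/
def oneR : ContMap (U.prod (Dp.prod Dom.unit)) (Dm.prod Dom.unit.lift) :=
  ⟨fun _ => (⊥, up Dom.unit ⟨⟩), by fun_prop⟩

/-- Wait. -/
noncomputable def oneL (g : ContMap (U.prod (Dp.prod Cm)) (Dm.prod Cp)) :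
    ContMap (U.prod (Dp.prod (Dom.unit.lift.prod Cm))) (Dm.prod (Dom.unit.prod Cp)) :=
  strictFn ⟨fun x => x.2.2.1, by fun_prop⟩
    ⟨fun (u, δ, _, γ) => ((g (u, δ, γ)).1, ⊥, (g (u, δ, γ)).2), by fun_prop⟩

/-- Downshift, provider. -/
def downR (g : ContMap (U.prod (Dp.prod Am)) (Dm.prod Ap)) :
    ContMap (U.prod (Dp.prod Am)) (Dm.prod Ap.lift) :=
  ⟨fun x => ((g x).1, up Ap (g x).2), by fun_prop⟩

/-- Downshift, client. -/
noncomputable def downL (g : ContMap (U.prod (Dp.prod (Ap.prod Cm))) (Dm.prod (Am.prod Cp))) :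
    ContMap (U.prod (Dp.prod (Ap.lift.prod Cm))) (Dm.prod (Am.prod Cp)) :=
  strictFn ⟨fun x => x.2.2.1, by fun_prop⟩ ⟨fun (u, δ, α, γ) => g (u, δ, down Ap α, γ), by fun_prop⟩

/-- Upshift, provider. -/
noncomputable def upR (g : ContMap (U.prod (Dp.prod Am)) (Dm.prod Ap)) :
    ContMap (U.prod (Dp.prod Am.lift)) (Dm.prod Ap) :=
  strictFn ⟨fun x => x.2.2, by fun_prop⟩ ⟨fun (u, δ, α) => g (u, δ, down Am α), by fun_prop⟩

/-- Upshift, client. -/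
def upL (g : ContMap (U.prod (Dp.prod (Ap.prod Cm))) (Dm.prod (Am.prod Cp))) :
    ContMap (U.prod (Dp.prod (Ap.prod Cm))) (Dm.prod (Am.lift.prod Cp)) :=
  ⟨fun x => ((g x).1, up Am (g x).2.1, (g x).2.2), by fun_prop⟩

/-- The element of a product with the component `x` at `k`, and `⊥` at every other index. -/
def piSingle {ι : Type} [DecidableEq ι] (D : ι → Dom) (k : ι) : ContMap (D k) (Dom.pi D) :=
  ⟨fun x l => if h : l = k then h ▸ x else ⊥, .of_pi fun l => by
    by_cases h : l = k
    · subst h; simp only [dite_true]; exact ScottContinuous.id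
    · simp [h]⟩

section Choice

variable {ι : Type} {Ep Em : ι → Dom}

/-- Internal choice, provider. -/
def plusR (k : ι) (g : ContMap (U.prod (Dp.prod (Em k))) (Dm.prod (Ep k))) :
    ContMap (U.prod (Dp.prod (Dom.pi Em))) (Dm.prod (Dom.csum Ep)) :=
  ⟨fun (u, δ, α) => ((g (u, δ, α k)).1, inject Ep k (g (u, δ, α k)).2), by fun_prop⟩

/-- Internal choice, client. -/
def plusL [DecidableEq ι]
    (g : ∀ k, ContMap (U.prod (Dp.prod ((Ep k).prod Cm))) (Dm.prod ((Em k).prod Cp))) :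
    ContMap (U.prod (Dp.prod ((Dom.csum Ep).prod Cm))) (Dm.prod ((Dom.pi Em).prod Cp)) :=
  ContMap.comp (E := (U.prod (Dp.prod Cm)).prod (Dom.csum Ep))
    (caseFn fun k => ⟨fun ((u, δ, γ), α) =>
      ((g k (u, δ, α, γ)).1, piSingle Em k (g k (u, δ, α, γ)).2.1, (g k (u, δ, α, γ)).2.2),
      by fun_prop⟩)
    ⟨fun (u, δ, α, γ) => ((u, δ, γ), α), by fun_prop⟩

/-- External choice, provider. -/
def ampR [DecidableEq ι] (g : ∀ k, ContMap (U.prod (Dp.prod (Em k))) (Dm.prod (Ep k))) :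
    ContMap (U.prod (Dp.prod (Dom.csum Em))) (Dm.prod (Dom.pi Ep)) :=
  ContMap.comp (E := (U.prod Dp).prod (Dom.csum Em))
    (caseFn fun k => ⟨fun ((u, δ), α) => ((g k (u, δ, α)).1, piSingle Ep k (g k (u, δ, α)).2),
      by fun_prop⟩)
    ⟨fun (u, δ, α) => ((u, δ), α), by fun_prop⟩

/-- External choice, client. -/
def ampL (k : ι) (g : ContMap (U.prod (Dp.prod ((Ep k).prod Cm))) (Dm.prod ((Em k).prod Cp))) :
    ContMap (U.prod (Dp.prod ((Dom.pi Ep).prod Cm))) (Dm.prod ((Dom.csum Em).prod Cp)) :=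
  ⟨fun (u, δ, α, γ) => ((g (u, δ, α k, γ)).1, inject Em k (g (u, δ, α k, γ)).2.1,
    (g (u, δ, α k, γ)).2.2), by fun_prop⟩

end Choice

/-- Channel transmission, provider. -/
def tensorR (g : ContMap (U.prod (Dp.prod Am)) (Dm.prod Ap)) :
    ContMap (U.prod (Dp.prod (Bp.prod (Bm.prod Am)))) (Dm.prod (Bm.prod (Bp.prod Ap).lift)) :=
  ⟨fun (u, δ, β, α) => ((g (u, δ, α.2)).1, α.1, up (Bp.prod Ap) (β, (g (u, δ, α.2)).2)),
    by fun_prop⟩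

/-- Channel transmission, client. -/
noncomputable def tensorL
    (g : ContMap (U.prod (Dp.prod (Ap.prod (Bp.prod Cm)))) (Dm.prod (Am.prod (Bm.prod Cp)))) :
    ContMap (U.prod (Dp.prod ((Bp.prod Ap).lift.prod Cm))) (Dm.prod ((Bm.prod Am).prod Cp)) :=
  strictFn ⟨fun x => x.2.2.1, by fun_prop⟩
    ⟨fun (u, δ, α, γ) =>
      let r := g (u, δ, (down _ α).2, (down _ α).1, γ)
      (r.1, (r.2.2.1, r.2.1), r.2.2.2), by fun_prop⟩

/-- Channel reception, provider. -/
noncomputable def lollyR (g : ContMap (U.prod (Dp.prod (Bp.prod Am))) (Dm.prod (Bm.prod Ap))) :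
    ContMap (U.prod (Dp.prod (Bp.prod Am).lift)) (Dm.prod (Bm.prod Ap)) :=
  strictFn ⟨fun x => x.2.2, by fun_prop⟩
    ⟨fun (u, δ, α) => g (u, δ, (down _ α).1, (down _ α).2), by fun_prop⟩

/-- Channel reception, client. -/
def lollyL (g : ContMap (U.prod (Dp.prod (Ap.prod Cm))) (Dm.prod (Am.prod Cp))) :
    ContMap (U.prod (Dp.prod (Bp.prod ((Bm.prod Ap).prod Cm))))
      (Dm.prod (Bm.prod ((Bp.prod Am).lift.prod Cp))) :=
  ⟨fun (u, δ, β, α, γ) =>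
    let r := g (u, δ, α.2, γ)
    (r.1, α.1, up (Bp.prod Am) (β, r.2.1), r.2.2), by fun_prop⟩

/-- Value transmission, provider. -/
noncomputable def andR (M : ContMap U T) (g : ContMap (U.prod (Dp.prod Am)) (Dm.prod Ap)) :
    ContMap (U.prod (Dp.prod Am)) (Dm.prod (T.prod Ap).lift) :=
  strictFn ⟨fun x => M x.1, by fun_prop⟩
    ⟨fun x => ((g x).1, up (T.prod Ap) (M x.1, (g x).2)), by fun_prop⟩

/-- Value transmission, client; `e (u, v)` is the environment `[u | x ↦ v]`. -/
noncomputable def andL {U' : Dom} (e : ContMap (U.prod T) U')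
    (g : ContMap (U'.prod (Dp.prod (Ap.prod Cm))) (Dm.prod (Am.prod Cp))) :
    ContMap (U.prod (Dp.prod ((T.prod Ap).lift.prod Cm))) (Dm.prod (Am.prod Cp)) :=
  strictFn ⟨fun x => x.2.2.1, by fun_prop⟩
    ⟨fun (u, δ, α, γ) => g (e (u, (down _ α).1), δ, (down _ α).2, γ), by fun_prop⟩

/-- Value reception, provider; `e (u, v)` is the environment `[u | x ↦ v]`. -/
noncomputable def impR {U' : Dom} (e : ContMap (U.prod T) U')
    (g : ContMap (U'.prod (Dp.prod Am)) (Dm.prod Ap)) :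
    ContMap (U.prod (Dp.prod (T.prod Am).lift)) (Dm.prod Ap) :=
  strictFn ⟨fun x => x.2.2, by fun_prop⟩
    ⟨fun (u, δ, α) => g (e (u, (down _ α).1), δ, (down _ α).2), by fun_prop⟩

/-- Value reception, client. -/
noncomputable def impL (M : ContMap U T)
    (g : ContMap (U.prod (Dp.prod (Ap.prod Cm))) (Dm.prod (Am.prod Cp))) :
    ContMap (U.prod (Dp.prod (Ap.prod Cm))) (Dm.prod ((T.prod Am).lift.prod Cp)) :=
  strictFn ⟨fun x => M x.1, by fun_prop⟩
    ⟨fun x => ((g x).1, up (T.prod Am) (M x.1, (g x).2.1), (g x).2.2), by fun_prop⟩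

/-- Recursive types, provider. -/
def recurR (fold : ContMap Ap Bp) (unfold : ContMap Bm Am)
    (g : ContMap (U.prod (Dp.prod Am)) (Dm.prod Ap)) :
    ContMap (U.prod (Dp.prod Bm)) (Dm.prod Bp) :=
  ⟨fun (u, δ, α) => ((g (u, δ, unfold α)).1, fold (g (u, δ, unfold α)).2), by fun_prop⟩

/-- Recursive types, client. -/
def recurL (fold : ContMap Am Bm) (unfold : ContMap Bp Ap)
    (g : ContMap (U.prod (Dp.prod (Ap.prod Cm))) (Dm.prod (Am.prod Cp))) :
    ContMap (U.prod (Dp.prod (Bp.prod Cm))) (Dm.prod (Bm.prod Cp)) :=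
  ⟨fun (u, δ, α, γ) =>
    let r := g (u, δ, unfold α, γ)
    (r.1, fold r.2.1, r.2.2), by fun_prop⟩

end Clause

namespace Clause

variable {U : Dom} {Δ : SCtx} {a b c : ℕ} {A B C : CType}

/-- Forwarding. -/
def fwd : ContMap U (procDom (Ctx.empty.ext a A) A) :=
  .curry ⟨fun (_, α, β) => (Ctx.mk (⊥, β), Ctx.get α), by fun_prop⟩

/-- Uncurrying, for a process that offers the affected channel. -/
def asProvider (f : ContMap U (procDom Δ A)) :
    ContMap (U.prod ((Δ.dom .pos).prod (A.dom .neg))) ((Δ.dom .neg).prod (A.dom .pos)) :=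
  ⟨fun x => f x.1 x.2, by fun_prop⟩

/-- Uncurrying, for a process that uses the affected channel `a`. -/
def asClient (f : ContMap U (procDom (Δ.ext a A) C)) :
    ContMap (U.prod ((Δ.dom .pos).prod ((A.dom .pos).prod (C.dom .neg))))
      ((Δ.dom .neg).prod ((A.dom .neg).prod (C.dom .pos))) :=
  ⟨fun (u, δ, α, γ) =>
    let r := f u (Ctx.mk (δ, α), γ)
    (Ctx.drop r.1, Ctx.get r.1, r.2), by fun_prop⟩

/-- Currying, inverse to `asClient`. -/
def ofClient (g : ContMap (U.prod ((Δ.dom .pos).prod ((A.dom .pos).prod (C.dom .neg))))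
      ((Δ.dom .neg).prod ((A.dom .neg).prod (C.dom .pos)))) :
    ContMap U (procDom (Δ.ext a A) C) :=
  .curry ⟨fun (u, x, γ) =>
    let r := g (u, Ctx.drop x, Ctx.get x, γ)
    (Ctx.mk (r.1, r.2.1), r.2.2), by fun_prop⟩

/-- Uncurrying, for a process that uses the affected channels `a` and `b`. -/
def asClient₂ (f : ContMap U (procDom ((Δ.ext a A).ext b B) C)) :
    ContMap (U.prod ((Δ.dom .pos).prod ((A.dom .pos).prod ((B.dom .pos).prod (C.dom .neg)))))
      ((Δ.dom .neg).prod ((A.dom .neg).prod ((B.dom .neg).prod (C.dom .pos)))) :=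
  ⟨fun (u, δ, α, β, γ) =>
    let r := f u (Ctx.mk (Ctx.mk (δ, α), β), γ)
    (Ctx.drop (Ctx.drop r.1), Ctx.get (Ctx.drop r.1), Ctx.get r.1, r.2), by fun_prop⟩

/-- Currying, inverse to `asClient₂`. -/
def ofClient₂
    (g : ContMap (U.prod ((Δ.dom .pos).prod ((A.dom .pos).prod ((B.dom .pos).prod (C.dom .neg)))))
      ((Δ.dom .neg).prod ((A.dom .neg).prod ((B.dom .neg).prod (C.dom .pos))))) :
    ContMap U (procDom ((Δ.ext a A).ext b B) C) :=
  .curry ⟨fun (u, x, γ) =>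
    let r := g (u, Ctx.drop (Ctx.drop x), Ctx.get (Ctx.drop x), Ctx.get x, γ)
    (Ctx.mk (Ctx.mk (r.1, r.2.1), r.2.2.1), r.2.2.2), by fun_prop⟩

/-- The product `f × g` of two processes that share the channel `a`. Its traced component consists
of the negative and the positive communications on `a`. -/
def cutBody {Δ₁ Δ₂ : SCtx} (f : procDom Δ₁ A) (g : procDom (Δ₂.ext a A) C) :
    ContMap (((SCtx.dom (Δ₁.union Δ₂) .pos).prod (C.dom .neg)).prod
        ((A.dom .neg).prod (A.dom .pos)))
      (((SCtx.dom (Δ₁.union Δ₂) .neg).prod (C.dom .pos)).prod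
        ((A.dom .neg).prod (A.dom .pos))) :=
  ⟨fun ((δ, γ), αm, αp) =>
    let r := f (Ctx.left δ, αm)
    let s := g (Ctx.mk (Ctx.right δ, αp), γ)
    ((Ctx.join (r.1, Ctx.drop s.1), s.2), Ctx.get s.1, r.2), by fun_prop⟩

/-- Composition: the trace, over the channel `a`, of the product of the two processes. -/
noncomputable def cut {Δ₁ Δ₂ : SCtx} (f : ContMap U (procDom Δ₁ A))
    (g : ContMap U (procDom (Δ₂.ext a A) C)) : ContMap U (procDom (Δ₁.union Δ₂) C) :=
  ⟨fun u => trace (cutBody (f u) (g u)), by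
    have h := (ContMap.curry (trace (A := U.prod ((SCtx.dom (Δ₁.union Δ₂) .pos).prod (C.dom .neg)))
      (B := (SCtx.dom (Δ₁.union Δ₂) .neg).prod (C.dom .pos))
      (X := (A.dom .neg).prod (A.dom .pos))
      ⟨fun ((u, δ, γ), αm, αp) =>
        let r := f u (Ctx.left δ, αm)
        let s := g u (Ctx.mk (Ctx.right δ, αp), γ)
        ((Ctx.join (r.1, Ctx.drop s.1), s.2), Ctx.get s.1, r.2), by fun_prop⟩)).cont
    exact h⟩

section Quote

variable {n : ℕ} {x : Fin n → ℕ} {E : Fin n → CType}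

/-- Replaces the names of the used channels of a process by their positions. -/
def toQuote (f : ContMap U (procDom (Ctx.ofFin x E) A)) :
    ContMap U (((Dom.pi fun i => (E i).dom .pos).prod (A.dom .neg)).fn
      ((Dom.pi fun i => (E i).dom .neg).prod (A.dom .pos))) :=
  .curry ⟨fun (u, δ, α) => (Ctx.toFin (f u (Ctx.fromFin δ, α)).1, (f u (Ctx.fromFin δ, α)).2),
    by fun_prop⟩

/-- Replaces the positions of the used channels of a process by their names. -/
def ofQuote (f : ContMap U (((Dom.pi fun i => (E i).dom .pos).prod (A.dom .neg)).fn
      ((Dom.pi fun i => (E i).dom .neg).prod (A.dom .pos)))) :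
    ContMap U (procDom (Ctx.ofFin x E) A) :=
  .curry ⟨fun (u, δ, α) => (Ctx.fromFin (f u (Ctx.toFin δ, α)).1, (f u (Ctx.toFin δ, α)).2),
    by fun_prop⟩

end Quote

end Clause

mutual

/-- The denotation `⟦Ψ ⊩ M : τ⟧ : ⟦Ψ⟧ → ⟦τ⟧`. -/
noncomputable def Term.den : ∀ {Ψ : FCtx} {τ : FType}, Term Ψ τ → ContMap Ψ.dom τ.den
  | _, _, .quote _ _ _ _ P => (up _).comp (Clause.toQuote P.den)
  | _, _, .var _ => Ctx.get
  | _, _, .fix _ M => sfix (M.den.comp Ctx.mk)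
  | _, _, .lam _ M => Clause.lam (M.den.comp Ctx.mk)
  | _, _, .app M N => Clause.app M.den N.den

/-- The denotation `⟦Ψ; Δ ⊢ P :: c : C⟧ : ⟦Ψ⟧ → [⟦Δ⟧⁺ × ⟦C⟧⁻ → ⟦Δ⟧⁻ × ⟦C⟧⁺]`. -/
noncomputable def Proc.den : ∀ {Ψ : FCtx} {Δ : SCtx} {c : ℕ} {C : CType},
    Proc Ψ Δ c C → ContMap Ψ.dom (procDom Δ C)
  | _, _, _, _, .fwd _ => Clause.fwd
  | _, _, _, _, .cut _ _ _ P Q => Clause.cut P.den Q.den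
  | _, _, _, _, .oneR => (Clause.oneR).curry
  | _, _, _, _, .oneL _ _ P => Clause.ofClient (Clause.oneL (Clause.asProvider P.den))
  | _, _, _, _, .downR P => (Clause.downR (Clause.asProvider P.den)).curry
  | _, _, _, _, .downL _ P => Clause.ofClient (Clause.downL (Clause.asClient P.den))
  | _, _, _, _, .upR P => (Clause.upR (Clause.asProvider P.den)).curry
  | _, _, _, _, .upL _ P => Clause.ofClient (Clause.upL (Clause.asClient P.den))
  | _, _, _, _, .plusR k P => (Clause.plusR k (Clause.asProvider P.den)).curry
  | _, _, _, _, .plusL _ _ _ P =>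
    Clause.ofClient (Clause.plusL fun k => Clause.asClient (P k).den)
  | _, _, _, _, .ampR _ P => (Clause.ampR fun k => Clause.asProvider (P k).den).curry
  | _, _, _, _, .ampL _ k P => Clause.ofClient (Clause.ampL k (Clause.asClient P.den))
  | _, _, _, _, .tensorR _ _ P =>
    Clause.ofClient (Clause.tensorR (Clause.asProvider P.den))
  | _, _, _, _, .tensorL _ _ _ P => Clause.ofClient (Clause.tensorL (Clause.asClient₂ P.den))
  | _, _, _, _, .lollyR _ P => (Clause.lollyR (Clause.asClient P.den)).curry
  | _, _, _, _, .lollyL _ _ _ _ P => Clause.ofClient₂ (Clause.lollyL (Clause.asClient P.den))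
  | _, _, _, _, .andR M P => (Clause.andR M.den (Clause.asProvider P.den)).curry
  | _, _, _, _, .andL _ _ P => Clause.ofClient (Clause.andL Ctx.mk (Clause.asClient P.den))
  | _, _, _, _, .impR _ P => (Clause.impR Ctx.mk (Clause.asProvider P.den)).curry
  | _, _, _, _, .impL _ M P => Clause.ofClient (Clause.impL M.den (Clause.asClient P.den))
  | _, _, _, _, .recurR (p := p) (A := A) P =>
    (Clause.recurR (A.fold .pos) (A.unfoldMap .neg) (Clause.asProvider P.den)).curry
  | _, _, _, _, .recurL (A := A) _ P =>
    Clause.ofClient (Clause.recurL (A.fold .neg) (A.unfoldMap .pos) (Clause.asClient P.den))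
  | _, _, _, _, .unquote _ _ _ _ M => Clause.ofQuote ((down _).comp M.den)

end

/-- Semantic equivalence `P ≡ Q` of processes. -/
def Proc.Equiv {Ψ : FCtx} {Δ : SCtx} {c : ℕ} {C : CType} (P Q : Proc Ψ Δ c C) : Prop :=
  P.den = Q.den

/-! ## Fixed points and traces along a lifting -/

-- Fix an environment and let `f`, `g` be the denotations of the two processes there; nothing else
-- about the processes matters. Each side of the equivalence is computed from a least fixed point of
-- the feedback along the channel `a`. On the left the feedback lives in `⟦A⟧⁻ × ⟦A⟧⁺`, on the right
-- in `⟦A⟧⁻ × ⟦A⟧⁺_⊥`. On an argument of the form `(x, [y])` the receiver strips the bracket and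
-- behaves like `g`, while the sender behaves like `f` and puts a bracket around its answer. So `i
-- (x, y) = (x, [y])` intertwines the left loop with the right one, and the external outputs agree
-- at corresponding points.
--
-- An intertwining map that is strict and continuous would carry the least fixed point to the least
-- fixed point, but `i` is not strict: it sends `(⊥, ⊥)` to `(⊥, [⊥])`. Hence `i` of the left least
-- fixed point is a fixed point of the right loop, but a smaller one outside the image of `i` has to
-- be excluded. The sender does this. Its positive output is `[·]` for every input, even on feedback
-- `⊥`, so no fixed point of the right loop has `⊥` as its positive component. Every fixed point on
-- the right is therefore `i` of a fixed point on the left, and since `i` is monotone the least ones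
-- correspond. The strictness of the receiver concerns only feedback `⊥`, which is never the
-- positive component of a fixed point.
--
-- The order-theoretic core is `fix_eq_of_conj`; `trace_lift` turns it into a statement about
-- traces, and `Clause.cut_down` applies that to the denotation of a cut. The remaining lemmas,
-- chiefly `Ctx.get_mk` and `Ctx.drop_mk`, show that packing the channel `a` into a context and
-- unpacking it again loses nothing.

/-- A monotone map that conjugates `g` into `h` sends `fix g` to `fix h`, provided that every fixed
point of `h` is the image of a fixed point of `g`. -/
theorem fix_eq_of_conj {D E : Dom} (g : ContMap D D) (h : ContMap E E) (i : D → E)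
    (hi : Monotone i) (hgh : ∀ x, h (i x) = i (g x))
    (hfix : ∀ y, h y = y → ∃ x, i x = y ∧ g x = x) : fix E h = i (fix D g) := by
  refine le_antisymm ((fix_spec h).1.2 ?_) ?_
  -- The image of a fixed point of `g` is a fixed point of `h`, in particular a pre-fixed point, so
  -- it lies above `fix E h`.
  · change h (i (fix D g)) ≤ i (fix D g)
    rw [hgh, (fix_spec g).2]
  -- Here `hfix` replaces strictness and continuity of `i`: it is applied only to `fix E h`, whose
  -- preimage `x` lies above `fix D g` because `x` is fixed by `g`.
  · obtain ⟨x, hx, hgx⟩ := hfix _ (fix_spec h).2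
    rw [← hx]
    exact hi ((fix_spec g).1.2 hgx.le)

/-- The trace is unchanged when a component of the feedback is lifted, provided that the feedback on
the lifted component is never `⊥`. -/
theorem trace_lift {A B X Y : Dom} (f : ContMap (A.prod (X.prod Y)) (B.prod (X.prod Y)))
    (f' : ContMap (A.prod (X.prod Y.lift)) (B.prod (X.prod Y.lift)))
    (hf : ∀ a x y, f' (a, x, up Y y) =
      ((f (a, x, y)).1, (f (a, x, y)).2.1, up Y (f (a, x, y)).2.2))
    (hbot : ∀ z, (f' z).2.2 ≠ ⊥) : trace f = trace f' := by
  refine ContMap.ext fun a => ?_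
  -- For a fixed external input `a`, `g` and `h` are the two feedback loops whose least fixed points
  -- define the traces.
  let g : ContMap (X.prod Y) (X.prod Y) := ⟨fun z => (f (a, z)).2, by fun_prop⟩
  let h : ContMap (X.prod Y.lift) (X.prod Y.lift) := ⟨fun z => (f' (a, z)).2, by fun_prop⟩
  have key : fix _ h = ((fix _ g).1, up Y (fix _ g).2) := by
    refine fix_eq_of_conj g h (fun z => (z.1, up Y z.2)) ?_ ?_ ?_
    · exact fun z w hzw => ⟨hzw.1, (up Y).cont.monotone hzw.2⟩
    · exact fun z => congrArg Prod.snd (hf a z.1 z.2)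
    · rintro ⟨x, y⟩ hy
      induction y using WithBot.recBotCoe with
      -- A fixed point with `⊥` in the lifted component would make `⊥` an output of `f'` there. This
      -- is the only use of `hbot`; the hypothesis `hf` says nothing about `f'` at such arguments.
      | bot => exact absurd (congrArg Prod.snd hy) (hbot _)
      | coe y =>
        -- On a lifted value `hf` expresses the loop `h` through `f`. Since `up` is injective, the
        -- bracket can be removed from the fixed-point equation, which leaves one for `g`.
        have e : ((f (a, x, y)).2.1, up Y (f (a, x, y)).2.2) = (x, up Y y) :=
          (congrArg Prod.snd (hf a x y)).symm.trans hy
        have e₁ : (f (a, x, y)).2.1 = x := congrArg Prod.fst e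
        have e₂ : (f (a, x, y)).2.2 = y := WithBot.coe_injective (congrArg Prod.snd e)
        exact ⟨(x, y), rfl, Prod.ext e₁ e₂⟩
  change (f (a, fix _ g)).1 = (f' (a, fix _ h)).1
  rw [key]
  exact (congrArg Prod.fst (hf a (fix _ g).1 (fix _ g).2)).symm

/-! ## Projections from extended contexts -/

namespace Ctx

variable {T : Type} {I : T → Dom} {Δ : Ctx T} {a : ℕ} {A : T}

/-- The type of a component depends on an `if`, so pairing and projection are defined by matching on
the decision `d`. Splitting on a general `d` makes both compute. -/
theorem iteFst_iteMk {P : Prop} (d : Decidable P) (hP : P) (o₁ o₂ : Option T)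
    (x : optDom I o₁) (y : optDom I o₂) : iteFst I d o₁ o₂ (iteMk I d o₁ o₂ (x, y)) = x := by
  cases d with
  | isTrue _ => rfl
  | isFalse h => exact absurd hP h

/-- When `P` holds, `iteMk` discards its second argument and `iteSnd` returns `⊥`. The round trip is
the identity in that case only because `o₂ = none` makes the second factor a single point. -/
theorem iteSnd_iteMk {P : Prop} (d : Decidable P) (o₁ o₂ : Option T) (h : P → o₂ = none)
    (x : optDom I o₁) (y : optDom I o₂) : iteSnd I d o₁ o₂ (iteMk I d o₁ o₂ (x, y)) = y := by
  cases d with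
  -- After the substitution both sides lie in the one-point domain, whose elements are
  -- definitionally equal.
  | isTrue hP => obtain rfl := h hP; rfl
  | isFalse _ => rfl

theorem get_mk (δ : Δ.dom I) (x : I A) : (get (mk (δ, x) : (Δ.ext a A).dom I) : I A) = x :=
  iteFst_iteMk (instDecidableEqNat a a) rfl (some A) (Δ a) x (δ a)

/-- Freshness of `a` is essential: extending at a name already in `Δ` overwrites the old component,
which `drop` could not recover. Away from `a` the components pass through unchanged. -/
theorem drop_mk (ha : Δ a = none) (δ : Δ.dom I) (x : I A) :
    (drop (mk (δ, x) : (Δ.ext a A).dom I) : Δ.dom I) = δ :=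
  funext fun n => iteSnd_iteMk (instDecidableEqNat n a) (some A) (Δ n)
    (fun h => h ▸ ha) x (δ n)

end Ctx

-- Cuts along a downshifted channel.

namespace Clause

/-- The client of a downshift agrees with the original client on lifted values. -/
theorem downL_up {U Dp Dm Ap Am Cp Cm : Dom}
    (g : ContMap (U.prod (Dp.prod (Ap.prod Cm))) (Dm.prod (Am.prod Cp)))
    (u : U) (δ : Dp) (α : Ap) (γ : Cm) :
    downL g (u, δ, up Ap α, γ) = g (u, δ, α, γ) :=
  -- A lifted value selects the non-strict branch of `strictFn`, and there `down` cancels `up` by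
  -- computation.
  if_neg WithBot.coe_ne_bot

/-- Composition along a channel is unchanged when the channel is downshifted. -/
theorem cut_down {U : Dom} {Δ₁ Δ₂ : SCtx} {a : ℕ} {A : SType [] .neg} {C : CType}
    (ha : Δ₂ a = none) (f : ContMap U (procDom Δ₁ ⟨_, A⟩))
    (g : ContMap U (procDom (Δ₂.ext a ⟨_, A⟩) C)) :
    cut f g = cut (A := ⟨_, .down A⟩) (downR (asProvider f)).curry
      (ofClient (a := a) (A := ⟨_, .down A⟩) (downL (asClient g))) := by
  refine ContMap.ext fun u => ?_
  -- The aspects of `↓A` unfold to `⟦A⟧⁻` and `⟦A⟧⁺_⊥`, so both cut bodies have the shape that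
  -- `trace_lift` expects. The condition on `⊥` holds because the fed-back positive component is the
  -- output of `downR`, which is an `up` for every input.
  refine trace_lift (X := A.dom .neg) (Y := A.dom .pos) _ _ ?_ fun _ => WithBot.coe_ne_bot
  rintro ⟨δ, γ⟩ x y
  -- The negative aspects of `A` and `↓A` coincide, so domains alone do not show which context a
  -- projection belongs to. The local names fix it as `Δ₂, a : ↓A`.
  let D : CType := ⟨_, .down A⟩
  let E : SCtx := Δ₂.ext a D
  let get (q : Pol) : ContMap (E.dom q) (D.dom q) := Ctx.get
  let drop (q : Pol) : ContMap (E.dom q) (Δ₂.dom q) := Ctx.drop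
  let z : E.dom .pos := Ctx.mk (Ctx.right δ, up (A.dom .pos) y)
  -- Input side of the receiver: the cut body packs `[y]` into the context and `ofClient` unpacks
  -- it. Once the two cancel, the strict client sees a lifted value and agrees with the original
  -- client at `y`.
  have hG : downL (asClient g) (u, drop .pos z, get .pos z, γ) =
      asClient g (u, Ctx.right δ, y, γ) := by
    have hd : drop .pos z = Ctx.right δ := Ctx.drop_mk ha _ _
    have hg : get .pos z = up (A.dom .pos) y := Ctx.get_mk _ _
    rw [hd, hg]
    exact downL_up _ _ _ _ _
  -- Output side: `F` assembles the result of the cut body from the client's answer `r`. `ofClient`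
  -- packs `r` into a context and the cut body unpacks it again; `hF` says that this detour is the
  -- identity.
  let F (r : (Δ₂.dom .neg).prod ((A.dom .neg).prod (C.dom .pos))) :
      ((SCtx.dom (Δ₁.union Δ₂) .neg).prod (C.dom .pos)).prod
        ((A.dom .neg).prod (A.dom .pos).lift) :=
    let w : E.dom .neg := Ctx.mk (r.1, r.2.1)
    ((Ctx.join ((f u (Ctx.left δ, x)).1, drop .neg w), r.2.2), get .neg w,
      up (A.dom .pos) (f u (Ctx.left δ, x)).2)
  have hF (r : (Δ₂.dom .neg).prod ((A.dom .neg).prod (C.dom .pos))) :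
      F r = ((Ctx.join ((f u (Ctx.left δ, x)).1, r.1), r.2.2), r.2.1,
        up (A.dom .pos) (f u (Ctx.left δ, x)).2) := by
    let w : E.dom .neg := Ctx.mk (r.1, r.2.1)
    have hd : drop .neg w = r.1 := Ctx.drop_mk ha _ _
    have hg : get .neg w = r.2.1 := Ctx.get_mk _ _
    change ((Ctx.join (_, drop .neg w), _), get .neg w, _) = _
    rw [hd, hg]
    rfl
  -- The left side of this equation is the body with shifts at `(x, [y])`. The right side is, by
  -- unfolding `asClient`, the body without shifts at `(x, y)` with its positive feedback lifted.
  exact (congrArg F hG).trans (hF _)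

end Clause

theorem mainTheorem6 (Ψ : FCtx) (Δ₁ Δ₂ : SCtx) (a c : ℕ) (A : SType [] .neg) (C : CType)
    (P : Proc Ψ Δ₁ a ⟨.neg, A⟩) (Q : Proc Ψ (Δ₂.ext a ⟨.neg, A⟩) c C)
    (h₁₂ : Δ₁.Disj Δ₂) (ha : Δ₂ a = none) (hc : Δ₁ c = none) :
    Proc.Equiv (.cut h₁₂ ha hc P Q) (.cut h₁₂ ha hc (.downR P) (.downL ha Q)) := by
  have h := Clause.cut_down ha P.den Q.den
  -- Unfolding the clauses for cut, `downR` and `downL` turns the equivalence into the equation of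
  -- `Clause.cut_down`.
  simpa only [Proc.Equiv, Proc.den] using h
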